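/- Let $\lambda=(\lambda_n)_{n\ge1}$ be a frequency, i.e. a strictly increasing sequence of non-negative reals tending to $+\infty$, satisfying Landau's condition $$(LC)\qquad \forall\,\delta>0\ \exists\,C>0\ \forall\, n\in\mathbb N:\quad \lambda_{n+1}-\lambda_n\ \ge\ C\,e^{-e^{\delta\lambda_n}}.$$ Let $(G,\beta)$ be a $\lambda$-Dirichlet group: $G$ is a compact (Hausdorff) abelian group, $\beta\colon(\mathbb R,+)\to G$ is a continuous homomorphism with dense range, and for every $n$ there is a (necessarily unique) continuous character $h_{\lambda_n}$ of $G$ with $h_{\lambda_n}(\beta(t))=e^{-i\lambda_n t}$ for all $t\in\mathbb R$. Let $\mu$ be the normalized (regular) Haar measure of $G$. For $f\in L_1(G)=L_1(\mu)$ and a character $\chi$ of $G$ put $\widehat f(\chi)=\int_G f\,\overline{\chi}\,d\mu$, and let $H_1^\lambda(G)$ be the space of all $f\in L_1(G)$ with $\widehat f(\chi)=0$ for every character $\chi\notin\{h_{\lambda_n}: n\in\mathbb N\}$. For $u>0$ let $p_u$ be the Poisson measure on $G$, i.e. the image under $\beta$ of the measure $\frac1\pi\frac{u}{u^2+t^2}\,dt$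 on $\mathbb R$, and put $(f*p_u)(\omega)=\int_G f(\omega\eta^{-1})\,dp_u(\eta)$. (i) For every $u>0$ the operator $$S^u_{\max}(f)(\omega)=\sup_{N}\Big|\sum_{n=1}^N\widehat f(h_{\lambda_n})\,e^{-u\lambda_n}\,h_{\lambda_n}(\omega)\Big|$$ is sublinear and bounded from $H_1^\lambda(G)$ to weak $L_1(G)$: there is a constant $C\geq 0$ such that for every $f\in H_1^\lambda(G)$ the function $S^u_{\max}(f)$ is measurable and almost everywhere finite, and $$\mu\big(\{\omega\in G: S^u_{\max}(f)(\omega)>\alpha\}\big)\le \frac{C\,\|f\|_1}{\alpha}\qquad\text{for all }\alpha>0 .$$ (ii) For every $f\in H_1^\lambda(G)$ there is a null set $N\subset G$ such that for every $\omega\notin N$ and every $u>0$ the integral defining $(f*p_u)(\omega)$ converges absolutely, the following series converges (as the limit of its partial sums), and $$(f*p_u)(\omega)=\sum_{n=1}^\infty\widehat f(h_{\lambda_n})\,e^{-u\lambda_n}\,h_{\lambda_n}(\omega).$$ -/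

import Mathlib

open MeasureTheory Filter Topology
open scoped ENNReal NNReal

/-- A frequency: a strictly increasing sequence of non-negative reals tending to `+∞`.
The sequence is indexed from `0`, so that `lam n` is the `(n+1)`-st member. -/
structure IsFrequency (lam : ℕ → ℝ) : Prop where
  strictMono : StrictMono lam
  nonneg : ∀ n, 0 ≤ lam n
  tendsto_atTop : Tendsto lam atTop atTop

/-- Landau's condition `(LC)`. -/
def LandauCondition (lam : ℕ → ℝ) : Prop :=
  ∀ δ : ℝ, 0 < δ → ∃ C : ℝ, 0 < C ∧
    ∀ n : ℕ, C * Real.exp (-Real.exp (δ * lam n)) ≤ lam (n + 1) - lam n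

section Groups

variable {G : Type*} [CommGroup G] [TopologicalSpace G]

/-- `χ ∘ β = e^{-i x ·}`, i.e. the character `χ` of `G` is the character `h_x`. -/
def IsCharacterAt (β : Multiplicative ℝ →ₜ* G) (x : ℝ) (χ : PontryaginDual G) : Prop :=
  ∀ t : ℝ, ((χ (β (Multiplicative.ofAdd t)) : Circle) : ℂ) =
    Complex.exp (-(Complex.I * (x : ℂ) * (t : ℂ)))

/-- `(G, β)`, with `β : (ℝ, +) → G` a continuous homomorphism, is a `lam`-Dirichlet group:
`β` has dense range and every `e^{-i lam n ·}` is of the form `χ ∘ β` for a character `χ` of `G`. -/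
structure IsDirichletGroup (lam : ℕ → ℝ) (β : Multiplicative ℝ →ₜ* G) : Prop where
  denseRange : DenseRange β
  exists_char : ∀ n, ∃ χ : PontryaginDual G, IsCharacterAt β (lam n) χ

/-- The character `h_{lam n}` of a `lam`-Dirichlet group. -/
noncomputable def IsDirichletGroup.char {lam : ℕ → ℝ} {β : Multiplicative ℝ →ₜ* G}
    (hG : IsDirichletGroup lam β) (n : ℕ) : PontryaginDual G :=
  Classical.choose (hG.exists_char n)

theorem IsDirichletGroup.char_spec {lam : ℕ → ℝ} {β : Multiplicative ℝ →ₜ* G}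
    (hG : IsDirichletGroup lam β) (n : ℕ) : IsCharacterAt β (lam n) (hG.char n) :=
  Classical.choose_spec (hG.exists_char n)

/-- The character `h_x` is unique. -/
theorem IsDirichletGroup.char_unique {lam : ℕ → ℝ} {β : Multiplicative ℝ →ₜ* G}
    (hG : IsDirichletGroup lam β) (n : ℕ) (χ : PontryaginDual G)
    (hχ : IsCharacterAt β (lam n) χ) : χ = hG.char n := by
  have hc : Continuous (fun ω => χ ω) := map_continuous χ
  have hc' : Continuous (fun ω => hG.char n ω) := map_continuous (hG.char n)
  have h : (fun ω => χ ω) = fun ω => hG.char n ω := by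
    refine hG.denseRange.equalizer hc hc' ?_
    funext t
    refine Subtype.ext ?_
    exact (hχ (Multiplicative.toAdd t)).trans (hG.char_spec n (Multiplicative.toAdd t)).symm
  exact PontryaginDual.ext fun ω => congrFun h ω

variable [MeasurableSpace G]

/-- The Fourier coefficient `∫ f(ω) conj(χ(ω)) dμ(ω)`. -/
noncomputable def groupFourierCoeff (μ : Measure G) (f : G → ℂ) (χ : PontryaginDual G) : ℂ :=
  ∫ ω, f ω * (starRingEnd ℂ) ((χ ω : Circle) : ℂ) ∂μ

/-- `f` belongs to the Hardy space `H_p^{lam}(G)`: it is an `L_p`-function whose Fourier transform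
is supported on the set of characters `h_{lam n}`. -/
structure MemHardy {lam : ℕ → ℝ} {β : Multiplicative ℝ →ₜ* G} (hG : IsDirichletGroup lam β)
    (p : ℝ≥0∞) (μ : Measure G) (f : G → ℂ) : Prop where
  memLp : MemLp f p μ
  fourier_support : ∀ χ : PontryaginDual G, χ ∉ Set.range hG.char → groupFourierCoeff μ f χ = 0

/-- The sum of the first `N` terms `f̂(h_{lam n}) e^{-u lam n} h_{lam n}(ω)`. -/
noncomputable def partialFourierSum {lam : ℕ → ℝ} {β : Multiplicative ℝ →ₜ* G}
    (hG : IsDirichletGroup lam β) (μ : Measure G) (u : ℝ) (f : G → ℂ) (N : ℕ) (ω : G) : ℂ :=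
  ∑ n ∈ Finset.range N,
    groupFourierCoeff μ f (hG.char n) * (Real.exp (-(u * lam n)) : ℂ) * ((hG.char n ω : Circle) : ℂ)

/-- The maximal operator `S_max^u`, with values in `[0, ∞]`. -/
noncomputable def maximalOperator {lam : ℕ → ℝ} {β : Multiplicative ℝ →ₜ* G}
    (hG : IsDirichletGroup lam β) (μ : Measure G) (u : ℝ) (f : G → ℂ) (ω : G) : ℝ≥0∞ :=
  ⨆ N : ℕ, ‖partialFourierSum hG μ u f (N + 1) ω‖ₑ

/-- The Poisson kernel of `ℝ`. -/
noncomputable def poissonKernelReal (u t : ℝ) : ℝ := 1 / Real.pi * (u / (u ^ 2 + t ^ 2))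

/-- The Poisson measure `p_u` on `G`: the image of `P_u(t) dt` under `β`. -/
noncomputable def poissonMeasureOn (β : Multiplicative ℝ →ₜ* G) (u : ℝ) : Measure G :=
  (volume.withDensity fun t : ℝ => ENNReal.ofReal (poissonKernelReal u t)).map
    fun t : ℝ => β (Multiplicative.ofAdd t)

/-- The convolution `f * ν` of a function and a measure on `G`. -/
noncomputable def convMeasure (f : G → ℂ) (ν : Measure G) (ω : G) : ℂ :=
  ∫ η, f (ω * η⁻¹) ∂ν

end Groups

section WeakL1

variable {Ω : Type*} [MeasurableSpace Ω]

/-- The weak `L_1` quasi-norm of a `[0, ∞]`-valued function. -/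
noncomputable def weakL1Norm (μ : Measure Ω) (g : Ω → ℝ≥0∞) : ℝ≥0∞ :=
  sInf {C : ℝ≥0∞ | ∀ α : ℝ≥0, 0 < α → μ {ω | (α : ℝ≥0∞) < g ω} ≤ C / α}

/-- A measurable, almost everywhere finite `[0, ∞]`-valued function with finite weak `L_1`
quasi-norm. -/
structure MemWeakL1 (μ : Measure Ω) (g : Ω → ℝ≥0∞) : Prop where
  measurable : Measurable g
  ae_lt_top : ∀ᵐ ω ∂μ, g ω < ∞
  norm_lt_top : weakL1Norm μ g < ∞

end WeakL1

/-! For fixed `ω` everything happens on the orbit `t ↦ f (ω * β(t)⁻¹)`. Convolution along orbits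
with an integrable kernel `K` multiplies the Fourier coefficient at `h_x` by `∫ K(t) e^{ixt} dt`.
The Poisson kernel has multiplier `e^{-ux}` for `x ≥ 0`. The cutoff kernel, which is the Poisson
kernel plus `truncKernel`, has multiplier `e^{-ux}` times the continuous piecewise linear function
that is `1` up to `λ_N` and `0` from `λ_{N+1}` on. No frequency lies strictly between these two, so
convolution with the cutoff kernel has the Fourier coefficients of the partial sum up to `λ_N`, and
by uniqueness it equals that partial sum almost everywhere (`partialFourierSum_ae_eq_integral`).

The partial sum therefore differs from `f * p_u` by a convolution with `truncKernel`. With `z = u +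
it`, this kernel is at most `e^{-uλ_N} min(|z|⁻¹, (λ_{N+1} - λ_N)⁻¹ |z|⁻²)`. Against the orbit it
costs a maximal function times `e^{-uλ_N}` times a constant plus the logarithm of the inverse gap.
Landau's condition bounds that logarithm by a constant plus `e^{δλ_N}`. With `δ = u/2` the error is
`O(e^{-uλ_N/2})` times the maximal function (`enorm_partialFourierSum_sub_le`). Boundedness of this
factor gives (i), and its decay gives (ii) directly, with no density argument.

The maximal function averages `|f|` over orbit segments of integer length in both directions. Its
weak type bound is the maximal ergodic theorem for the time-one map of the flow
(`measure_lt_flowMax_le`). Uniqueness of Fourier coefficients rests on characters separating points,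
which comes from Gelfand theory for the commutative von Neumann algebra generated by the
translations of `L²(G)`, followed by Stone-Weierstrass. -/

set_option linter.overlappingInstances false
set_option linter.unusedSectionVars false

/-! ### Translation and convolution operators on `L²(G)` -/

section PeterWeyl

variable {G : Type*} [CommGroup G] [TopologicalSpace G] [IsTopologicalGroup G]
  [CompactSpace G] [T2Space G] [MeasurableSpace G] [BorelSpace G]
  (μ : Measure G) [μ.IsHaarMeasure] [μ.Regular] [IsProbabilityMeasure μ]

/-- Translation by `ω` as a unitary operator on `L²(G)`. -/
noncomputable def translationL2 (ω : G) : Lp ℂ 2 μ ≃ₗᵢ[ℂ] Lp ℂ 2 μ where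
  toFun v := DomMulAct.mk ω • v
  invFun v := DomMulAct.mk ω⁻¹ • v
  left_inv v := by simp [smul_smul]
  right_inv v := by simp [smul_smul]
  map_add' v w := smul_add _ v w
  map_smul' c v := smul_comm _ c v
  norm_map' v := DomMulAct.norm_smul_Lp _ v

/-- `translationL2` as an element of the algebra of bounded operators. -/
noncomputable def translationOp (ω : G) : Lp ℂ 2 μ →L[ℂ] Lp ℂ 2 μ :=
  (translationL2 μ ω : Lp ℂ 2 μ →L[ℂ] Lp ℂ 2 μ)

theorem translationOp_apply (ω : G) (v : Lp ℂ 2 μ) :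
    translationOp μ ω v = DomMulAct.mk ω • v := rfl

theorem norm_translationOp_apply (ω : G) (v : Lp ℂ 2 μ) : ‖translationOp μ ω v‖ = ‖v‖ :=
  DomMulAct.norm_smul_Lp _ v

theorem translationOp_mul (ω η : G) :
    translationOp μ (ω * η) = translationOp μ ω * translationOp μ η := by
  ext1 v
  simp [translationOp_apply, smul_smul, ← DomMulAct.mk_mul, mul_comm]

theorem translationOp_one : translationOp μ (1 : G) = 1 := by
  ext1 v
  simp [translationOp_apply]

theorem star_translationOp (ω : G) : star (translationOp μ ω) = translationOp μ ω⁻¹ :=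
  LinearIsometryEquiv.adjoint_eq_symm (translationL2 μ ω)

theorem continuous_translationOp_apply (v : Lp ℂ 2 μ) :
    Continuous fun ω : G => translationOp μ ω v := by
  have : Fact ((2 : ℝ≥0∞) ≠ ∞) := ⟨by simp⟩
  have : Continuous fun ω : G => DomMulAct.mk ω • v :=
    (DomMulAct.mkHomeomorph.continuous).smul continuous_const
  exact this

theorem integrable_smul_translationOp (h : C(G, ℂ)) (v : Lp ℂ 2 μ) :
    Integrable (fun ω => h ω • translationOp μ ω v) μ :=
  (h.continuous.smul (continuous_translationOp_apply μ v)).integrable_of_hasCompactSupport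
    (HasCompactSupport.of_compactSpace _)

/-- The convolution operator `v ↦ ∫ h(ω) U_ω v dω` on `L²(G)`. -/
noncomputable def convolutionOp (h : C(G, ℂ)) : Lp ℂ 2 μ →L[ℂ] Lp ℂ 2 μ :=
  LinearMap.mkContinuous
    { toFun := fun v => ∫ ω, h ω • translationOp μ ω v ∂μ
      map_add' := fun v w => by
        simp only [map_add, smul_add]
        exact integral_add (integrable_smul_translationOp μ h v)
          (integrable_smul_translationOp μ h w)
      map_smul' := fun c v => by
        simp only [map_smul, smul_comm _ c, integral_smul, RingHom.id_apply] }
    ‖h‖ fun v => by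
      have := norm_integral_le_of_norm_le_const (μ := μ) (C := ‖h‖ * ‖v‖)
        (f := fun ω => h ω • translationOp μ ω v) (ae_of_all _ fun ω => by
          rw [norm_smul, norm_translationOp_apply]
          gcongr
          exact h.norm_coe_le_norm ω)
      simpa using this

theorem convolutionOp_apply (h : C(G, ℂ)) (v : Lp ℂ 2 μ) :
    convolutionOp μ h v = ∫ ω, h ω • translationOp μ ω v ∂μ := rfl

theorem norm_convolutionOp_le (h : C(G, ℂ)) : ‖convolutionOp μ h‖ ≤ ‖h‖ :=
  LinearMap.mkContinuous_norm_le _ (norm_nonneg _) _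

theorem convolutionOp_sub (h k : C(G, ℂ)) :
    convolutionOp μ (h - k) = convolutionOp μ h - convolutionOp μ k := by
  ext1 v
  simp only [convolutionOp_apply, sub_apply, ContinuousMap.sub_apply, sub_smul]
  exact integral_sub (integrable_smul_translationOp μ h v) (integrable_smul_translationOp μ k v)

theorem continuous_convolutionOp : Continuous (convolutionOp μ : C(G, ℂ) → _) :=
  (LipschitzWith.of_dist_le_mul (K := 1) fun h k => by
    rw [dist_eq_norm, dist_eq_norm, ← convolutionOp_sub]
    simpa using norm_convolutionOp_le μ (h - k)).continuous

theorem commute_convolutionOp (h : C(G, ℂ)) (B : Lp ℂ 2 μ →L[ℂ] Lp ℂ 2 μ)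
    (hB : ∀ ω, B * translationOp μ ω = translationOp μ ω * B) :
    B * convolutionOp μ h = convolutionOp μ h * B := by
  ext1 v
  simp only [mul_apply_eq_comp, convolutionOp_apply]
  rw [← ContinuousLinearMap.integral_comp_comm _ (integrable_smul_translationOp μ h v)]
  congr 1 with ω : 1
  rw [map_smul]
  congr 1
  exact congrArg (fun T => T v) (hB ω)

/-- The translate `ω ↦ h (g⁻¹ ω)` of a continuous function, depending continuously on `g`. -/
noncomputable def translateFun (h : C(G, ℂ)) : C(G, C(G, ℂ)) :=
  ContinuousMap.curry ⟨fun p : G × G => h (p.1⁻¹ * p.2), by fun_prop⟩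

/-- Invariance of Haar measure moves the group element into the convolving function. There the
dependence on `g` is continuous in operator norm, whereas for `translationOp μ g` itself only strong
continuity is available. -/
theorem translationOp_mul_convolutionOp (h : C(G, ℂ)) (g : G) :
    translationOp μ g * convolutionOp μ h = convolutionOp μ (translateFun h g) := by
  ext1 v
  simp only [mul_apply_eq_comp, convolutionOp_apply]
  rw [← ContinuousLinearMap.integral_comp_comm _ (integrable_smul_translationOp μ h v),
    ← integral_mul_left_eq_self (fun ω => translateFun h g ω • translationOp μ ω v) g]
  congr 1 with ω : 1
  rw [map_smul, translationOp_mul]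
  simp [translateFun]

/-- Continuous bumps at `1` form an approximate identity for `convolutionOp`. -/
theorem exists_norm_convolutionOp_sub_lt (v : Lp ℂ 2 μ) {ε : ℝ} (hε : 0 < ε) :
    ∃ h : C(G, ℂ), ‖convolutionOp μ h v - v‖ ≤ ε := by
  have hcont := continuous_translationOp_apply μ v
  have hV : {ω : G | ‖translationOp μ ω v - v‖ < ε} ∈ 𝓝 (1 : G) := by
    refine (isOpen_lt (by fun_prop) continuous_const).mem_nhds ?_
    simp [translationOp_one, hε]
  obtain ⟨V, hVs, hVo, h1V⟩ := mem_nhds_iff.1 hV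
  obtain ⟨φ, h0, h1, hφ⟩ := exists_continuous_zero_one_of_isClosed
    (hVo.isClosed_compl) (isClosed_singleton (x := (1 : G))) (by simpa using h1V)
  have hφi : Integrable (fun ω => φ ω) μ :=
    φ.continuous.integrable_of_hasCompactSupport (HasCompactSupport.of_compactSpace _)
  have hpos : 0 < ∫ ω, φ ω ∂μ := by
    refine φ.continuous.integral_pos_of_hasCompactSupport_nonneg_nonzero
      (HasCompactSupport.of_compactSpace _) (fun ω => (hφ ω).1) (x := 1) ?_
    rw [h1 rfl]; simp
  set c := ∫ ω, φ ω ∂μ with hc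
  refine ⟨⟨fun ω => ((φ ω / c : ℝ) : ℂ), by fun_prop⟩, ?_⟩
  have hint := integrable_smul_translationOp μ
    (⟨fun ω => ((φ ω / c : ℝ) : ℂ), by fun_prop⟩ : C(G, ℂ)) v
  -- The vector `v` is its own average against the normalized bump, so the difference to be
  -- estimated is the average of `U_ω v - v`, and only `ω ∈ V` contributes.
  have hv : v = ∫ ω, (((φ ω / c : ℝ) : ℂ)) • v ∂μ := by
    rw [integral_smul_const, integral_complex_ofReal, integral_div, ← hc, div_self hpos.ne']
    simp
  have hint2 : Integrable (fun ω => (((φ ω / c : ℝ) : ℂ)) • v) μ :=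
    ((hφi.div_const c).ofReal).smul_const v
  rw [convolutionOp_apply]
  conv_lhs => rw [hv]
  simp only [ContinuousMap.coe_mk] at hint ⊢
  have hb : ‖∫ ω, (((φ ω / c : ℝ) : ℂ)) • (translationOp μ ω v - v) ∂μ‖
      ≤ ∫ ω, φ ω / c * ε ∂μ := by
    refine norm_integral_le_of_norm_le ((hφi.div_const c).mul_const ε) (ae_of_all _ fun ω => ?_)
    rw [norm_smul, Complex.norm_real, Real.norm_of_nonneg (div_nonneg (hφ ω).1 hpos.le)]
    by_cases hω : ω ∈ V
    · have : ‖translationOp μ ω v - v‖ < ε := hVs hω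
      have := div_nonneg (hφ ω).1 hpos.le
      gcongr
    · rw [h0 hω]; simp
  rw [integral_mul_const, integral_div, ← hc, div_self hpos.ne', one_mul] at hb
  refine le_trans (le_of_eq ?_) hb
  rw [← hv]
  congr 1
  conv_lhs => rw [hv, ← hv]
  simp only [smul_sub]
  rw [integral_sub hint hint2, ← hv]

end PeterWeyl

/-! ### Characters separate points, by Gelfand theory -/

section Separation

variable {G : Type*} [CommGroup G] [TopologicalSpace G] [IsTopologicalGroup G]
  [CompactSpace G] [T2Space G] [MeasurableSpace G] [BorelSpace G]
  (μ : Measure G) [μ.IsHaarMeasure] [μ.Regular] [IsProbabilityMeasure μ]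

/-- The von Neumann algebra generated by the translations. -/
noncomputable def translationAlgebra : StarSubalgebra ℂ (Lp ℂ 2 μ →L[ℂ] Lp ℂ 2 μ) :=
  StarSubalgebra.centralizer ℂ
    (StarSubalgebra.centralizer ℂ (Set.range (translationOp μ)) : Set (Lp ℂ 2 μ →L[ℂ] Lp ℂ 2 μ))

theorem mem_centralizer_translationOp (B : Lp ℂ 2 μ →L[ℂ] Lp ℂ 2 μ) :
    B ∈ StarSubalgebra.centralizer ℂ (Set.range (translationOp μ)) ↔
      ∀ ω, B * translationOp μ ω = translationOp μ ω * B := by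
  rw [StarSubalgebra.mem_centralizer_iff]
  constructor
  · intro h ω
    exact (h _ ⟨ω, rfl⟩).1.symm
  · rintro h _ ⟨ω, rfl⟩
    rw [star_translationOp]
    exact ⟨(h ω).symm, (h ω⁻¹).symm⟩

/-- The commutant of the translations is closed under adjoints, so the star half of the bicommutant
condition follows from the other half. -/
theorem mem_translationAlgebra (B : Lp ℂ 2 μ →L[ℂ] Lp ℂ 2 μ)
    (h : ∀ D : Lp ℂ 2 μ →L[ℂ] Lp ℂ 2 μ,
      (∀ ω, D * translationOp μ ω = translationOp μ ω * D) → D * B = B * D) :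
    B ∈ translationAlgebra μ := by
  rw [translationAlgebra, StarSubalgebra.mem_centralizer_iff]
  intro D hD
  have hD' := star_mem hD
  exact ⟨h _ ((mem_centralizer_translationOp μ _).1 hD),
    h _ ((mem_centralizer_translationOp μ _).1 hD')⟩

theorem translationOp_mem (ω : G) : translationOp μ ω ∈ translationAlgebra μ :=
  mem_translationAlgebra μ _ fun _ hD => hD ω

theorem convolutionOp_mem (h : C(G, ℂ)) : convolutionOp μ h ∈ translationAlgebra μ :=
  mem_translationAlgebra μ _ fun D hD => commute_convolutionOp μ h D hD

/-- The translations commute with each other, so they lie in their own commutant. Hence the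
bicommutant is contained in the commutant, and its elements commute with one another. -/
theorem translationAlgebra_comm (x y : Lp ℂ 2 μ →L[ℂ] Lp ℂ 2 μ)
    (hx : x ∈ translationAlgebra μ) (hy : y ∈ translationAlgebra μ) : x * y = y * x := by
  have hU (z) (hz : z ∈ translationAlgebra μ) (ω : G) :
      z * translationOp μ ω = translationOp μ ω * z := by
    rw [translationAlgebra, StarSubalgebra.mem_centralizer_iff] at hz
    refine ((hz (translationOp μ ω) ?_).1).symm
    refine (mem_centralizer_translationOp μ _).2 fun η => ?_
    rw [← translationOp_mul, ← translationOp_mul, mul_comm]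
  rw [translationAlgebra, StarSubalgebra.mem_centralizer_iff] at hx
  exact ((hx y ((mem_centralizer_translationOp μ _).2 (hU y hy))).1).symm

instance isClosed_translationAlgebra :
    IsClosed (translationAlgebra μ : Set (Lp ℂ 2 μ →L[ℂ] Lp ℂ 2 μ)) :=
  Set.isClosed_centralizer _

noncomputable instance : CommCStarAlgebra (translationAlgebra μ) where
  mul_comm x y := Subtype.ext (translationAlgebra_comm μ x y x.2 y.2)

/-- A multiplicative functional that does not vanish on some convolution operator yields
a continuous character of the group. -/
theorem exists_pontryaginDual_of_characterSpace
    (φ : WeakDual.characterSpace ℂ (translationAlgebra μ)) (h : C(G, ℂ))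
    (hφ : φ ⟨convolutionOp μ h, convolutionOp_mem μ h⟩ ≠ 0) :
    ∃ χ : PontryaginDual G, ∀ ω, (χ ω : ℂ) = φ ⟨translationOp μ ω, translationOp_mem μ ω⟩ := by
  set F : G → ℂ := fun ω => φ ⟨translationOp μ ω, translationOp_mem μ ω⟩ with hF
  have hmul (ω η : G) : F (ω * η) = F ω * F η := by
    simp only [hF, ← map_mul]
    congr 1
    exact Subtype.ext (translationOp_mul μ ω η)
  have hone : F 1 = 1 := by
    simp only [hF]
    rw [← map_one φ]
    congr 1
    exact Subtype.ext (translationOp_one μ)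
  have hnorm (ω : G) : ‖F ω‖ = 1 := by
    have hstar : F ω⁻¹ = star (F ω) := by
      simp only [hF, ← map_star]
      congr 1
      exact Subtype.ext (star_translationOp μ ω).symm
    have h1 : star (F ω) * F ω = 1 := by rw [← hstar, ← hmul, inv_mul_cancel, hone]
    have h2 : ‖F ω‖ * ‖F ω‖ = 1 := by
      rw [← CStarRing.norm_star_mul_self, h1, norm_one]
    nlinarith [norm_nonneg (F ω)]
  -- Multiplying by the nonzero number `φ(T_h)` replaces `U_ω` by the convolution operator of a
  -- translate of `h`, which is norm continuous in `ω`. Dividing by `φ(T_h)` gives continuity of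
  -- `F`.
  have hcont : Continuous F := by
    have h1 : Continuous fun ω => φ ⟨convolutionOp μ (translateFun h ω), convolutionOp_mem μ _⟩ :=
      (map_continuous φ).comp (Continuous.subtype_mk
        ((continuous_convolutionOp μ).comp (translateFun h).continuous) _)
    have h2 : F = fun ω => φ ⟨convolutionOp μ (translateFun h ω), convolutionOp_mem μ _⟩ /
        φ ⟨convolutionOp μ h, convolutionOp_mem μ h⟩ := by
      funext ω
      rw [eq_div_iff hφ]
      simp only [hF, ← map_mul]
      congr 1
      exact Subtype.ext (translationOp_mul_convolutionOp μ h ω)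
    rw [h2]
    exact h1.div_const _
  let χ : G →ₜ* Circle :=
    { toFun := fun ω => ⟨F ω, mem_sphere_zero_iff_norm.2 (hnorm ω)⟩
      map_one' := Subtype.ext hone
      map_mul' := fun ω η => Subtype.ext (hmul ω η)
      continuous_toFun := hcont.subtype_mk fun ω => mem_sphere_zero_iff_norm.2 (hnorm ω) }
  exact ⟨χ, fun _ => rfl⟩

/-- Otherwise `U_g` would fix the range of every convolution operator, hence every vector by the
approximate identity. A continuous function that takes different values at `g` and `1` rules this
out. -/
theorem exists_translationOp_mul_convolutionOp_ne (g : G) (hg : g ≠ 1) :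
    ∃ h : C(G, ℂ), translationOp μ g * convolutionOp μ h ≠ convolutionOp μ h := by
  by_contra! hcon
  have hfix (v : Lp ℂ 2 μ) : translationOp μ g v = v := by
    refine sub_eq_zero.1 (norm_le_zero_iff.1 (le_of_forall_pos_le_add fun ε hε => ?_))
    obtain ⟨h, hh⟩ := exists_norm_convolutionOp_sub_lt μ v (half_pos hε)
    have h1 : translationOp μ g (convolutionOp μ h v) = convolutionOp μ h v :=
      congrArg (fun T => T v) (hcon h)
    have h2 : translationOp μ g v - v =
        translationOp μ g (v - convolutionOp μ h v) + (convolutionOp μ h v - v) := by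
      rw [map_sub, h1]; abel
    rw [h2]
    refine (norm_add_le _ _).trans ?_
    rw [norm_translationOp_apply, norm_sub_rev]
    linarith
  obtain ⟨φ, h0, h1, -⟩ := exists_continuous_zero_one_of_isClosed
    (isClosed_singleton (x := g)) (isClosed_singleton (x := (1 : G))) (by simpa using hg)
  let k : C(G, ℂ) := ⟨fun ω => (φ ω : ℂ), by fun_prop⟩
  have hk : MemLp k 2 μ := k.continuous.memLp_of_hasCompactSupport
    (HasCompactSupport.of_compactSpace _)
  have h2 : (fun ω => k (g * ω)) =ᵐ[μ] k := by
    have h3 : DomMulAct.mk g • hk.toLp k = hk.toLp k := hfix (hk.toLp k)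
    have h4 := DomMulAct.smul_Lp_ae_eq (DomMulAct.mk g) (hk.toLp k)
    rw [h3] at h4
    have h5 := (measurePreserving_mul_left μ g).quasiMeasurePreserving.ae_eq_comp hk.coeFn_toLp
    filter_upwards [h4, hk.coeFn_toLp, h5] with ω e1 e2 e3
    simp only [Function.comp] at e3
    rw [← e2, e1, ← e3]
    rfl
  have h6 := (Continuous.ae_eq_iff_eq μ (by fun_prop) k.continuous).1 h2
  have h7 := congrFun h6 1
  simp [k, h0 rfl, h1 rfl] at h7

/-- The characters of a compact abelian group separate points. -/
theorem exists_pontryaginDual_apply_ne_one (μ : Measure G) [μ.IsHaarMeasure] [μ.Regular]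
    [IsProbabilityMeasure μ] (g : G) (hg : g ≠ 1) :
    ∃ χ : PontryaginDual G, χ g ≠ 1 := by
  obtain ⟨h, hh⟩ := exists_translationOp_mul_convolutionOp_ne μ g hg
  set T : translationAlgebra μ := ⟨convolutionOp μ h, convolutionOp_mem μ h⟩ with hT
  set U : translationAlgebra μ := ⟨translationOp μ g, translationOp_mem μ g⟩ with hU
  have hne : U * T ≠ T := fun e => hh (congrArg Subtype.val e)
  -- Injectivity of the Gelfand transform gives `φ` with `φ(U) φ(T) ≠ φ(T)`. This forces both `φ(T)
  -- ≠ 0`, so that `φ` induces a character of `G`, and `φ(U) ≠ 1`.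
  have := (gelfandTransform_isometry (translationAlgebra μ)).injective.ne hne
  obtain ⟨φ, hφ⟩ := DFunLike.ne_iff.1 this
  have hφ' : φ U * φ T ≠ φ T := by
    rw [← map_mul]
    exact hφ
  have hφT : φ T ≠ 0 := by
    intro e
    simp [e] at hφ'
  obtain ⟨χ, hχ⟩ := exists_pontryaginDual_of_characterSpace μ φ h hφT
  refine ⟨χ, fun e => hφ' ?_⟩
  rw [← hχ g, e]
  simp

end Separation

/-! ### Density of trigonometric polynomials and uniqueness of Fourier coefficients -/

section Uniqueness

/-- An integrable function which annihilates all continuous functions vanishes almost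
everywhere. -/
theorem ae_eq_zero_of_integral_mul_continuous_eq_zero {X : Type*} [TopologicalSpace X]
    [CompactSpace X] [T2Space X] [MeasurableSpace X] [BorelSpace X] (μ : Measure X)
    [IsFiniteMeasure μ] [μ.Regular] {f : X → ℂ} (hf : Integrable f μ)
    (h : ∀ φ : C(X, ℂ), ∫ x, f x * φ x ∂μ = 0) : f =ᵐ[μ] 0 := by
  refine ae_eq_zero_of_forall_setIntegral_isClosed_eq_zero hf fun s hs => ?_
  refine norm_le_zero_iff.1 (le_of_forall_pos_le_add fun ε hε => ?_)
  rw [zero_add]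
  -- Absolute continuity of the integral fixes how tightly `U` must surround `s`. A Urysohn function
  -- equal to `1` on `s` and `0` off `U` then reproduces the integral over `s` up to an error
  -- carried by `U \ s`.
  obtain ⟨δ, hδ, hδs⟩ := exists_pos_setLIntegral_lt_of_measure_lt
    (μ := μ) (f := fun x => ‖f x‖ₑ) hf.2.ne (ε := ENNReal.ofReal ε) (by simpa using hε)
  obtain ⟨U, hsU, hUo, hU⟩ := hs.measurableSet.exists_isOpen_sdiff_lt (measure_ne_top μ s) hδ.ne'
  obtain ⟨φ, h0, h1, hφ⟩ := exists_continuous_zero_one_of_isClosed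
    hUo.isClosed_compl hs (Set.disjoint_compl_left_iff_subset.2 hsU)
  have hφ0 := h ⟨fun x => (φ x : ℂ), by fun_prop⟩
  simp only [ContinuousMap.coe_mk] at hφ0
  have hi : Integrable (fun x => f x * (φ x : ℂ)) μ := by
    refine hf.mul_bdd (c := 1) (by fun_prop) (ae_of_all _ fun x => ?_)
    rw [Complex.norm_real, Real.norm_of_nonneg (hφ x).1]
    exact (hφ x).2
  have hsplit : ∫ x in s, f x ∂μ = -∫ x in U \ s, f x * (φ x : ℂ) ∂μ := by
    have e1 : ∫ x in s, f x ∂μ = ∫ x in s, f x * (φ x : ℂ) ∂μ :=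
      setIntegral_congr_fun hs.measurableSet fun x hx => by simp [h1 hx]
    have e2 : ∫ x in U, f x * (φ x : ℂ) ∂μ = 0 := by
      rw [setIntegral_eq_integral_of_forall_compl_eq_zero, hφ0]
      intro x hx
      simp [h0 hx]
    have e3 := setIntegral_union (μ := μ) (f := fun x => f x * (φ x : ℂ))
      (s := s) (t := U \ s) Set.disjoint_sdiff_right
      (hUo.measurableSet.diff hs.measurableSet) hi.integrableOn hi.integrableOn
    rw [Set.union_sdiff_cancel hsU, e2] at e3
    rw [e1]
    linear_combination -e3
  rw [hsplit, norm_neg]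
  have hlt := hδs _ hU.2
  have h2 : ‖∫ x in U \ s, f x * (φ x : ℂ) ∂μ‖ₑ ≤ ENNReal.ofReal ε := by
    refine (enorm_integral_le_lintegral_enorm _).trans (le_trans (lintegral_mono fun x => ?_) hlt.le)
    rw [enorm_mul]
    refine mul_le_of_le_one_right' ?_
    rw [← ofReal_norm, Complex.norm_real, Real.norm_of_nonneg (hφ x).1]
    exact ENNReal.ofReal_le_one.2 (hφ x).2
  rw [← ofReal_norm] at h2
  exact (ENNReal.ofReal_le_ofReal_iff hε.le).1 h2

variable {G : Type*} [CommGroup G] [TopologicalSpace G] [IsTopologicalGroup G]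
  [CompactSpace G] [T2Space G] [MeasurableSpace G] [BorelSpace G]
  (μ : Measure G) [μ.IsHaarMeasure] [μ.Regular] [IsProbabilityMeasure μ]

/-- A character as a continuous complex-valued function. -/
noncomputable def PontryaginDual.toContinuousMap (χ : PontryaginDual G) : C(G, ℂ) :=
  ⟨fun ω => (χ ω : ℂ), continuous_subtype_val.comp (map_continuous χ)⟩

theorem PontryaginDual.coe_inv_apply (χ : PontryaginDual G) (ω : G) :
    ((χ⁻¹ ω : Circle) : ℂ) = (starRingEnd ℂ) (χ ω) :=
  Circle.coe_inv_eq_conj (χ ω)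

/-- The span of the characters, a star subalgebra of the continuous functions. -/
noncomputable def trigPolynomials (G : Type*) [CommGroup G] [TopologicalSpace G]
    [IsTopologicalGroup G] [CompactSpace G] : StarSubalgebra ℂ C(G, ℂ) where
  toSubalgebra := Submodule.toSubalgebra
    (Submodule.span ℂ (Set.range (PontryaginDual.toContinuousMap (G := G))))
    (Submodule.subset_span ⟨1, by ext; simp [PontryaginDual.toContinuousMap]⟩)
    (fun x y hx hy => by
      have := Submodule.mul_mem_mul hx hy
      rw [Submodule.span_mul_span] at this
      refine Submodule.span_mono ?_ this
      rintro _ ⟨_, ⟨χ, rfl⟩, _, ⟨ψ, rfl⟩, rfl⟩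
      refine ⟨χ * ψ, ?_⟩
      ext
      rfl)
  star_mem' := fun {x} hx => by
    change x ∈ Submodule.span ℂ _ at hx
    change star x ∈ Submodule.span ℂ _
    induction hx using Submodule.span_induction with
    | mem x hx =>
      obtain ⟨χ, rfl⟩ := hx
      refine Submodule.subset_span ⟨χ⁻¹, ?_⟩
      ext ω
      exact Circle.coe_inv_eq_conj (χ ω)
    | zero => simp
    | add x y _ _ h1 h2 => rw [star_add]; exact add_mem h1 h2
    | smul c x _ h => rw [star_smul]; exact Submodule.smul_mem _ _ h

theorem topologicalClosure_trigPolynomials (μ : Measure G) [μ.IsHaarMeasure] [μ.Regular]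
    [IsProbabilityMeasure μ] :
    (trigPolynomials G).topologicalClosure = ⊤ := by
  refine ContinuousMap.starSubalgebra_topologicalClosure_eq_top_of_separatesPoints _ ?_
  intro x y hxy
  obtain ⟨χ, hχ⟩ := exists_pontryaginDual_apply_ne_one μ (x * y⁻¹) (by
    simpa [mul_inv_eq_one] using hxy)
  refine ⟨_, ⟨χ.toContinuousMap, Submodule.subset_span ⟨χ, rfl⟩, rfl⟩, fun e => hχ ?_⟩
  rw [map_mul, map_inv, mul_inv_eq_one]
  exact Subtype.ext e

/-- Uniqueness of Fourier coefficients. -/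
theorem ae_eq_zero_of_groupFourierCoeff_eq_zero {f : G → ℂ} (hf : Integrable f μ)
    (h : ∀ χ, groupFourierCoeff μ f χ = 0) : f =ᵐ[μ] 0 := by
  refine ae_eq_zero_of_integral_mul_continuous_eq_zero μ hf fun φ => ?_
  have hint (φ : C(G, ℂ)) : Integrable (fun ω => f ω * φ ω) μ :=
    hf.mul_bdd (c := ‖φ‖) (by fun_prop) (ae_of_all _ φ.norm_coe_le_norm)
  have hcl : IsClosed {φ : C(G, ℂ) | ∫ ω, f ω * φ ω ∂μ = 0} := by
    refine isClosed_eq ?_ continuous_const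
    refine (LipschitzWith.of_dist_le_mul (K := (∫ ω, ‖f ω‖ ∂μ).toNNReal) fun φ ψ => ?_).continuous
    rw [dist_eq_norm, ← integral_sub (hint φ) (hint ψ),
      Real.coe_toNNReal _ (integral_nonneg fun _ => norm_nonneg _), dist_eq_norm,
      ← integral_mul_const]
    refine norm_integral_le_of_norm_le (hf.norm.mul_const _) (ae_of_all _ fun ω => ?_)
    rw [← mul_sub, norm_mul]
    gcongr
    exact (φ - ψ).norm_coe_le_norm ω
  have hmem : φ ∈ (trigPolynomials G).topologicalClosure := by
    rw [topologicalClosure_trigPolynomials μ]; trivial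
  refine closure_minimal ?_ hcl hmem
  intro x hx
  change x ∈ Submodule.span ℂ _ at hx
  change ∫ ω, f ω * x ω ∂μ = 0
  induction hx using Submodule.span_induction with
  | mem x hx =>
    obtain ⟨χ, rfl⟩ := hx
    have := h χ⁻¹
    rw [groupFourierCoeff] at this
    rw [← this]
    congr 1 with ω : 1
    simp [PontryaginDual.toContinuousMap, PontryaginDual.coe_inv_apply]
  | zero => simp
  | add x y _ _ h1 h2 =>
    simp only [ContinuousMap.add_apply, mul_add]
    rw [integral_add (hint x) (hint y), h1, h2, add_zero]
  | smul c x _ h =>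
    simp only [ContinuousMap.smul_apply, smul_eq_mul, mul_left_comm _ c]
    rw [integral_const_mul, h, mul_zero]

end Uniqueness

/-! ### Poisson and truncation kernels on the line -/

section Kernels

open Complex (I)

/-- Fourier inversion in angular frequency. -/
theorem integral_mul_exp_of_fourier {g F : ℝ → ℂ} (hc : Continuous g) (hi : Integrable g)
    (hF : ∀ t : ℝ, ∫ x : ℝ, Complex.exp (-(I * x * t)) * g x = F t) (hFi : Integrable F) (x : ℝ) :
    ∫ t : ℝ, F t * Complex.exp (I * x * t) = 2 * Real.pi * g x := by
  have h2 : (2 * Real.pi : ℝ) ≠ 0 := by positivity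
  have h1 : FourierTransform.fourier g = fun w : ℝ => F (2 * Real.pi * w) := by
    funext w
    rw [Real.fourier_real_eq_integral_exp_smul, ← hF]
    congr 1 with v : 1
    rw [smul_eq_mul]
    congr 2
    push_cast
    ring
  have h3 : Integrable (FourierTransform.fourier g) := by
    rw [h1]
    exact hFi.comp_mul_left' h2
  have h4 := congrFun (hc.fourierInv_fourier_eq hi h3) x
  rw [h1, Real.fourierInv_eq'] at h4
  rw [← h4]
  have h5 := Measure.integral_comp_mul_left
    (fun t : ℝ => F t * Complex.exp (I * x * t)) (2 * Real.pi)
  have h6 : ∫ v : ℝ, Complex.exp (↑(2 * Real.pi * inner ℝ v x) * I) • F (2 * Real.pi * v) =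
      ∫ v : ℝ, F (2 * Real.pi * v) * Complex.exp (I * x * (2 * Real.pi * v : ℝ)) := by
    congr 1 with v : 1
    rw [smul_eq_mul, mul_comm]
    congr 2
    simp only [RCLike.inner_apply, conj_trivial]
    push_cast
    ring
  rw [h6, h5, abs_of_pos (by positivity), Complex.real_smul]
  push_cast
  field_simp

theorem add_I_mul_ne_zero {u : ℝ} (hu : 0 < u) (t : ℝ) : (u : ℂ) + I * t ≠ 0 := by
  intro h
  have := congrArg Complex.re h
  simp at this
  exact hu.ne' this

theorem sq_norm_add_I_mul (u t : ℝ) : ‖(u : ℂ) + I * t‖ ^ 2 = u ^ 2 + t ^ 2 := by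
  rw [← Complex.normSq_eq_norm_sq, mul_comm, Complex.normSq_add_mul_I]

theorem integrable_inv_sq_add_sq {u : ℝ} (hu : 0 < u) :
    Integrable fun t : ℝ => (u ^ 2 + t ^ 2)⁻¹ := by
  have h := ((integrable_inv_one_add_sq).comp_div hu.ne').const_mul (u ^ 2)⁻¹
  refine h.congr (ae_of_all _ fun t => ?_)
  simp only
  rw [← mul_inv]
  congr 1
  field_simp

theorem integrable_inv_add_I_mul_sq {u : ℝ} (hu : 0 < u) :
    Integrable fun t : ℝ => (((u : ℂ) + I * t) ^ 2)⁻¹ := by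
  refine (integrable_inv_sq_add_sq hu).mono' ?_ (ae_of_all _ fun t => ?_)
  · exact (Continuous.inv₀ (by fun_prop) fun t => pow_ne_zero _ (add_I_mul_ne_zero hu t)).aestronglyMeasurable
  · rw [norm_inv, norm_pow, sq_norm_add_I_mul]

theorem tendsto_mul_exp_neg_mul_atTop {u : ℝ} (hu : 0 < u) :
    Tendsto (fun y : ℝ => y * Real.exp (-(u * y))) atTop (𝓝 0) := by
  have h := ((Real.tendsto_pow_mul_exp_neg_atTop_nhds_zero 1).comp
    (tendsto_id.const_mul_atTop hu)).const_mul u⁻¹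
  rw [mul_zero] at h
  refine h.congr fun y => ?_
  simp only [Function.comp, id, pow_one]
  field_simp

/-- The Laplace transform of the identity on a vertical line. -/
theorem integral_mul_cexp_neg_mul_Ioi {u : ℝ} (hu : 0 < u) (t : ℝ)
    (hint : IntegrableOn (fun y : ℝ => (y : ℂ) * Complex.exp (-(((u : ℂ) + I * t) * y)))
      (Set.Ioi 0)) :
    ∫ y in Set.Ioi (0 : ℝ), (y : ℂ) * Complex.exp (-(((u : ℂ) + I * t) * y)) =
      (((u : ℂ) + I * t) ^ 2)⁻¹ := by
  have hz := add_I_mul_ne_zero hu t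
  set z : ℂ := (u : ℂ) + I * t with hzdef
  have hre : z.re = u := by simp [hzdef]
  have hnorm (y : ℝ) : ‖Complex.exp (-(z * y))‖ = Real.exp (-(u * y)) := by
    rw [Complex.norm_exp]
    simp [hre]
  have hlim1 : Tendsto (fun y : ℝ => (y : ℂ) * Complex.exp (-(z * y))) atTop (𝓝 0) := by
    rw [tendsto_zero_iff_norm_tendsto_zero]
    refine (tendsto_mul_exp_neg_mul_atTop hu).congr' ?_
    filter_upwards [eventually_ge_atTop 0] with y hy
    rw [norm_mul, hnorm, Complex.norm_real, Real.norm_of_nonneg hy]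
  have hlim2 : Tendsto (fun y : ℝ => Complex.exp (-(z * y))) atTop (𝓝 0) := by
    rw [tendsto_zero_iff_norm_tendsto_zero]
    simp only [hnorm]
    exact Real.tendsto_exp_neg_atTop_nhds_zero.comp (tendsto_id.const_mul_atTop hu)
  have hlim : Tendsto (fun y : ℝ => -(z⁻¹ * ((y : ℂ) * Complex.exp (-(z * y))) +
      (z ^ 2)⁻¹ * Complex.exp (-(z * y)))) atTop (𝓝 0) := by
    simpa using ((hlim1.const_mul z⁻¹).add (hlim2.const_mul (z ^ 2)⁻¹)).neg
  rw [integral_Ioi_of_hasDerivAt_of_tendsto' (fun y _ => ?_) hint hlim]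
  · simp
  · have h1 : HasDerivAt (fun y : ℝ => (y : ℂ)) 1 y := Complex.ofRealCLM.hasDerivAt
    have h2 : HasDerivAt (fun y : ℝ => Complex.exp (-(z * y)))
        (Complex.exp (-(z * y)) * -(z * 1)) y := (h1.const_mul z).neg.cexp
    have h3 := (((h1.mul h2).const_mul z⁻¹).add (h2.const_mul (z ^ 2)⁻¹)).neg
    refine h3.congr_deriv ?_
    field_simp
    ring

/-- The Laplace transform exhibits `(u + it)⁻²` as the Fourier transform of the continuous function
`max y 0 * e^{-uy}`, and both are integrable, so inversion holds at every point. A sharp jump would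
produce `(u + it)⁻¹`, which is not integrable; this is why the cutoff is a linear ramp. -/
theorem integral_inv_sq_mul_exp {u : ℝ} (hu : 0 < u) (x : ℝ) :
    ∫ t : ℝ, (((u : ℂ) + I * t) ^ 2)⁻¹ * Complex.exp (I * x * t) =
      2 * Real.pi * (max x 0 * Real.exp (-(u * x)) : ℝ) := by
  have hind : (fun y : ℝ => max y 0 * Real.exp (-(u * y))) =
      (Set.Ioi 0).indicator fun y => y * Real.exp (-(u * y)) := by
    funext y
    by_cases hy : 0 < y
    · rw [Set.indicator_of_mem (Set.mem_Ioi.2 hy), max_eq_left hy.le]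
    · rw [Set.indicator_of_notMem (by simpa using hy), max_eq_right (not_lt.1 hy), zero_mul]
  have hint : Integrable fun y : ℝ => max y 0 * Real.exp (-(u * y)) := by
    rw [hind, integrable_indicator_iff measurableSet_Ioi]
    have := integrableOn_rpow_mul_exp_neg_mul_rpow (s := 1) (p := 1) (b := u)
      (by norm_num) one_pos hu
    simpa using this
  refine integral_mul_exp_of_fourier (g := fun y : ℝ => ((max y 0 * Real.exp (-(u * y)) : ℝ) : ℂ))
    (by fun_prop) hint.ofReal (fun t => ?_) (integrable_inv_add_I_mul_sq hu) x
  have h2 : (fun y : ℝ => Complex.exp (-(I * y * t)) * ((max y 0 * Real.exp (-(u * y)) : ℝ) : ℂ)) =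
      (Set.Ioi 0).indicator fun y : ℝ => (y : ℂ) * Complex.exp (-(((u : ℂ) + I * t) * y)) := by
    funext y
    rw [congrFun hind y]
    by_cases hy : 0 < y
    · rw [Set.indicator_of_mem (Set.mem_Ioi.2 hy), Set.indicator_of_mem (Set.mem_Ioi.2 hy)]
      push_cast
      rw [mul_left_comm, ← Complex.exp_add]
      congr 2
      ring
    · rw [Set.indicator_of_notMem (by simpa using hy), Set.indicator_of_notMem (by simpa using hy)]
      simp
  have h3 : Integrable
      fun y : ℝ => Complex.exp (-(I * y * t)) * ((max y 0 * Real.exp (-(u * y)) : ℝ) : ℂ) := by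
    refine hint.ofReal.bdd_mul (c := 1) (Continuous.aestronglyMeasurable (by fun_prop))
      (ae_of_all _ fun y => ?_)
    rw [Complex.norm_exp]
    simp
  rw [h2, integrable_indicator_iff measurableSet_Ioi] at h3
  rw [h2, integral_indicator measurableSet_Ioi, integral_mul_cexp_neg_mul_Ioi hu t h3]

theorem integrable_poissonKernelReal {u : ℝ} (hu : 0 < u) : Integrable (poissonKernelReal u) := by
  refine ((integrable_inv_sq_add_sq hu).const_mul (1 / Real.pi * u)).congr (ae_of_all _ fun t => ?_)
  simp [poissonKernelReal, div_eq_mul_inv, mul_assoc]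

/-- The Fourier transform of the Poisson kernel. -/
theorem integral_poissonKernelReal_mul_exp {u : ℝ} (hu : 0 < u) (x : ℝ) :
    ∫ t : ℝ, (poissonKernelReal u t : ℂ) * Complex.exp (I * x * t) =
      (Real.exp (-(u * |x|)) : ℝ) := by
  have hz (t : ℝ) : (u : ℂ) - I * t ≠ 0 := by
    have := add_I_mul_ne_zero hu (-t)
    simpa [sub_eq_add_neg] using this
  have hR (t : ℝ) : IntegrableOn (fun y : ℝ => Complex.exp (-((u : ℂ) + I * t) * y)) (Set.Ioi 0) :=
    integrableOn_exp_mul_complex_Ioi (by simpa using hu) 0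
  have hL (t : ℝ) : IntegrableOn (fun y : ℝ => Complex.exp (((u : ℂ) - I * t) * y)) (Set.Iic 0) :=
    integrableOn_exp_mul_complex_Iic (by simpa using hu) 0
  have eR (t : ℝ) : Set.EqOn (fun y : ℝ => Complex.exp (-((u : ℂ) + I * t) * y))
      (fun y : ℝ => Complex.exp (-(I * y * t)) * (Real.exp (-(u * |y|)) : ℝ)) (Set.Ioi 0) := by
    intro y hy
    simp only [abs_of_pos (Set.mem_Ioi.1 hy)]
    push_cast
    rw [← Complex.exp_add]
    congr 1
    ring
  have eL (t : ℝ) : Set.EqOn (fun y : ℝ => Complex.exp (((u : ℂ) - I * t) * y))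
      (fun y : ℝ => Complex.exp (-(I * y * t)) * (Real.exp (-(u * |y|)) : ℝ)) (Set.Iic 0) := by
    intro y hy
    simp only [abs_of_nonpos (Set.mem_Iic.1 hy)]
    push_cast
    rw [← Complex.exp_add]
    congr 1
    ring
  have hRi (t : ℝ) := (hR t).congr_fun (eR t) measurableSet_Ioi
  have hLi (t : ℝ) := (hL t).congr_fun (eL t) measurableSet_Iic
  have hint (t : ℝ) : Integrable
      (fun y : ℝ => Complex.exp (-(I * y * t)) * (Real.exp (-(u * |y|)) : ℝ)) := by
    rw [← integrableOn_univ, ← Set.Iic_union_Ioi (a := (0 : ℝ))]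
    exact (hLi t).union (hRi t)
  -- The easy direction is that `e^{-u|y|}` transforms to `2π` times the Poisson kernel, by two
  -- exponential integrals. Inversion gives the other direction.
  have hF := integral_mul_exp_of_fourier
    (g := fun y : ℝ => ((Real.exp (-(u * |y|)) : ℝ) : ℂ))
    (F := fun t => 2 * Real.pi * (poissonKernelReal u t : ℂ))
    (by fun_prop) (by simpa using hint 0) (fun t => ?_)
    ((integrable_poissonKernelReal hu).ofReal.const_mul _) x
  · simp only [mul_assoc (2 * (Real.pi : ℂ))] at hF
    rw [integral_const_mul] at hF
    exact mul_left_cancel₀ (by simp [Real.pi_ne_zero]) hF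
  · rw [← setIntegral_univ, ← Set.Iic_union_Ioi (a := (0 : ℝ)),
      setIntegral_union (Set.Iic_disjoint_Ioi le_rfl) measurableSet_Ioi (hLi t) (hRi t),
      ← setIntegral_congr_fun measurableSet_Ioi (eR t),
      ← setIntegral_congr_fun measurableSet_Iic (eL t),
      integral_exp_mul_complex_Ioi (by simpa using hu),
      integral_exp_mul_complex_Iic (by simpa using hu)]
    have h1 := add_I_mul_ne_zero hu t
    have h2 := hz t
    have h3 : (u : ℂ) ^ 2 + (t : ℂ) ^ 2 = (u + I * t) * (u - I * t) := by
      linear_combination (t : ℂ) ^ 2 * Complex.I_sq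
    have hpi : (Real.pi : ℂ) ≠ 0 := by simp [Real.pi_ne_zero]
    simp only [poissonKernelReal]
    push_cast
    rw [h3]
    simp only [mul_zero, Complex.exp_zero]
    field_simp
    ring

/-- The difference of the kernel which truncates Dirichlet series between the frequencies `a`
and `b` after applying the Poisson kernel, and the Poisson kernel itself. -/
noncomputable def truncKernel (a b u t : ℝ) : ℂ :=
  -(1 / (2 * Real.pi * (b - a)) : ℝ) *
    ((Complex.exp (-(a * ((u : ℂ) + I * t))) - Complex.exp (-(b * ((u : ℂ) + I * t)))) *
      (((u : ℂ) + I * t) ^ 2)⁻¹)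

theorem norm_exp_neg_mul_add_I_mul (a u t : ℝ) :
    ‖Complex.exp (-(a * ((u : ℂ) + I * t)))‖ = Real.exp (-(u * a)) := by
  rw [Complex.norm_exp]
  simp [mul_comm]

theorem continuous_truncKernel (a b : ℝ) {u : ℝ} (hu : 0 < u) : Continuous (truncKernel a b u) := by
  unfold truncKernel
  have : Continuous fun t : ℝ => (((u : ℂ) + I * t) ^ 2)⁻¹ :=
    Continuous.inv₀ (by fun_prop) fun t => pow_ne_zero _ (add_I_mul_ne_zero hu t)
  fun_prop

/-- The triangle inequality for the two exponentials. This bound is integrable but degenerates as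
the gap closes. -/
theorem norm_truncKernel_le_quadratic {a b u : ℝ} (hab : a < b) (hu : 0 < u) (t : ℝ) :
    ‖truncKernel a b u t‖ ≤ Real.exp (-(u * a)) * ((b - a)⁻¹ * (u ^ 2 + t ^ 2)⁻¹) := by
  have hd : 0 < b - a := sub_pos.2 hab
  have h1 : ‖Complex.exp (-(a * ((u : ℂ) + I * t))) - Complex.exp (-(b * ((u : ℂ) + I * t)))‖
      ≤ 2 * Real.exp (-(u * a)) := by
    refine (norm_sub_le _ _).trans ?_
    rw [norm_exp_neg_mul_add_I_mul, norm_exp_neg_mul_add_I_mul, two_mul]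
    gcongr
  rw [truncKernel, norm_mul, norm_neg, Complex.norm_real, Real.norm_of_nonneg (by positivity),
    norm_mul, norm_inv, norm_pow, sq_norm_add_I_mul]
  calc 1 / (2 * Real.pi * (b - a)) * (_ * (u ^ 2 + t ^ 2)⁻¹)
      ≤ 1 / (2 * 1 * (b - a)) * (2 * Real.exp (-(u * a)) * (u ^ 2 + t ^ 2)⁻¹) := by
        have := Real.pi_gt_three
        gcongr
        linarith
    _ = _ := by field_simp

/-- The mean value inequality on `[a, b]` cancels the factor `(b - a)⁻¹`. This bound is uniform in
the gap but not integrable; the minimum of the two bounds has an integral logarithmic in the gap. -/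
theorem norm_truncKernel_le_linear {a b u : ℝ} (hab : a < b) (hu : 0 < u) (t : ℝ) :
    ‖truncKernel a b u t‖ ≤ Real.exp (-(u * a)) * ‖(u : ℂ) + I * t‖⁻¹ := by
  have hd : 0 < b - a := sub_pos.2 hab
  set z : ℂ := (u : ℂ) + I * t with hz
  have hz0 : 0 < ‖z‖ := norm_pos_iff.2 (add_I_mul_ne_zero hu t)
  have h1 : ‖Complex.exp (-(a * z)) - Complex.exp (-(b * z))‖
      ≤ (Real.exp (-(u * a)) * ‖z‖) * (b - a) := by
    have := norm_image_sub_le_of_norm_deriv_le_segment' (a := a) (b := b)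
      (f := fun s : ℝ => Complex.exp (-(s * z))) (f' := fun s => Complex.exp (-(s * z)) * (-z))
      (C := Real.exp (-(u * a)) * ‖z‖) (fun s _ => ?_) (fun s hs => ?_) b ⟨hab.le, le_rfl⟩
    · rw [norm_sub_rev]; exact this
    · have h := ((Complex.ofRealCLM.hasDerivAt (x := s)).mul_const z).neg.cexp
      simpa using h.hasDerivWithinAt
    · rw [norm_mul, norm_neg, norm_exp_neg_mul_add_I_mul]
      have := hs.1
      gcongr
  rw [truncKernel, norm_mul, norm_neg, Complex.norm_real, Real.norm_of_nonneg (by positivity),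
    norm_mul, norm_inv, norm_pow]
  calc 1 / (2 * Real.pi * (b - a)) * (_ * (‖z‖ ^ 2)⁻¹)
      ≤ 1 / (1 * (b - a)) * ((Real.exp (-(u * a)) * ‖z‖) * (b - a) * (‖z‖ ^ 2)⁻¹) := by
        have := Real.pi_gt_three
        gcongr
        linarith
    _ = _ := by field_simp

theorem integrable_truncKernel {a b u : ℝ} (hab : a < b) (hu : 0 < u) :
    Integrable (truncKernel a b u) :=
  (((integrable_inv_sq_add_sq hu).const_mul (b - a)⁻¹).const_mul (Real.exp (-(u * a)))).mono'
    (continuous_truncKernel a b hu).aestronglyMeasurable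
    (ae_of_all _ (norm_truncKernel_le_quadratic hab hu))

/-- The factor `e^{-cz}` with `z = u + it` shifts `x` to `x - c`, so the two exponentials give ramps
starting at `a` and at `b`. Their normalized difference is `0` left of `a` and `1` right of `b`. -/
theorem integral_truncKernel_mul_exp {a b u : ℝ} (hab : a < b) (hu : 0 < u) (x : ℝ) :
    ∫ t : ℝ, truncKernel a b u t * Complex.exp (I * x * t) =
      (-(Real.exp (-(u * x)) * ((max (x - a) 0 - max (x - b) 0) / (b - a))) : ℝ) := by
  have hshift (c : ℝ) (t : ℝ) :
      Complex.exp (-(c * ((u : ℂ) + I * t))) * (((u : ℂ) + I * t) ^ 2)⁻¹ *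
        Complex.exp (I * x * t) = (Real.exp (-(u * c)) : ℝ) *
          ((((u : ℂ) + I * t) ^ 2)⁻¹ * Complex.exp (I * (x - c : ℝ) * t)) := by
    have : Complex.exp (-(c * ((u : ℂ) + I * t))) * Complex.exp (I * x * t) =
        (Real.exp (-(u * c)) : ℝ) * Complex.exp (I * (x - c : ℝ) * t) := by
      push_cast
      rw [← Complex.exp_add, ← Complex.exp_add]
      congr 1
      ring
    linear_combination (((u : ℂ) + I * t) ^ 2)⁻¹ * this
  have hi (c : ℝ) : Integrable fun t : ℝ => (Real.exp (-(u * c)) : ℂ) *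
          ((((u : ℂ) + I * t) ^ 2)⁻¹ * Complex.exp (I * (x - c : ℝ) * t)) := by
    refine Integrable.const_mul ?_ _
    refine (integrable_inv_add_I_mul_sq hu).mul_bdd (c := 1)
      (Continuous.aestronglyMeasurable (by fun_prop)) (ae_of_all _ fun t => ?_)
    rw [Complex.norm_exp]
    simp
  have hval (c : ℝ) : ∫ t : ℝ, (Real.exp (-(u * c)) : ℂ) *
          ((((u : ℂ) + I * t) ^ 2)⁻¹ * Complex.exp (I * (x - c : ℝ) * t)) =
          2 * Real.pi * (Real.exp (-(u * x)) * max (x - c) 0 : ℝ) := by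
    rw [integral_const_mul, integral_inv_sq_mul_exp hu]
    have : Real.exp (-(u * c)) * Real.exp (-(u * (x - c))) = Real.exp (-(u * x)) := by
      rw [← Real.exp_add]; congr 1; ring
    rw [← this]
    push_cast
    ring
  have hEq (t : ℝ) : truncKernel a b u t * Complex.exp (I * x * t) =
      -(1 / (2 * Real.pi * (b - a)) : ℝ) * ((Real.exp (-(u * a)) : ℂ) *
          ((((u : ℂ) + I * t) ^ 2)⁻¹ * Complex.exp (I * (x - a : ℝ) * t)) -
          (Real.exp (-(u * b)) : ℂ) *
          ((((u : ℂ) + I * t) ^ 2)⁻¹ * Complex.exp (I * (x - b : ℝ) * t))) := by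
    rw [← hshift a t, ← hshift b t, truncKernel]
    ring
  simp only [hEq]
  rw [integral_const_mul, integral_sub (hi a) (hi b), hval, hval]
  have hd : (b : ℂ) - a ≠ 0 := by exact_mod_cast (sub_pos.2 hab).ne'
  have hpi : (Real.pi : ℂ) ≠ 0 := by simp [Real.pi_ne_zero]
  push_cast
  field_simp

end Kernels

/-! ### The maximal ergodic theorem -/

section MaximalErgodic

variable {Ω : Type*} [MeasurableSpace Ω] {μ : Measure Ω} {T : Ω → Ω}

theorem integrable_birkhoffSum (hT : MeasurePreserving T μ μ) {g : Ω → ℝ} (hg : Integrable g μ)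
    (n : ℕ) : Integrable (birkhoffSum T g n) μ :=
  integrable_finsetSum _ fun k _ => (hT.iterate k).integrable_comp_of_integrable hg

/-- The maximum of the first Birkhoff sums, including the empty one. -/
noncomputable def birkhoffMax (T : Ω → Ω) (g : Ω → ℝ) : ℕ → Ω → ℝ
  | 0 => 0
  | n + 1 => birkhoffMax T g n ⊔ birkhoffSum T g (n + 1)

theorem birkhoffSum_le_birkhoffMax (T : Ω → Ω) (g : Ω → ℝ) {m n : ℕ} (hmn : m ≤ n) (ω : Ω) :
    birkhoffSum T g m ω ≤ birkhoffMax T g n ω := by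
  induction n with
  | zero => simp [Nat.le_zero.1 hmn, birkhoffMax]
  | succ n ih =>
    rcases Nat.lt_or_eq_of_le hmn with h | rfl
    · exact (ih (Nat.lt_succ_iff.1 h)).trans le_sup_left
    · exact le_sup_right

theorem exists_birkhoffMax_eq (T : Ω → Ω) (g : Ω → ℝ) (n : ℕ) (ω : Ω) :
    ∃ m ≤ n, birkhoffMax T g n ω = birkhoffSum T g m ω := by
  induction n with
  | zero => exact ⟨0, le_rfl, by simp [birkhoffMax]⟩
  | succ n ih =>
    obtain ⟨m, hm, h⟩ := ih
    rcases le_total (birkhoffMax T g n ω) (birkhoffSum T g (n + 1) ω) with h1 | h1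
    · exact ⟨n + 1, le_rfl, sup_eq_right.2 h1⟩
    · exact ⟨m, by omega, (sup_eq_left.2 h1).trans h⟩

theorem integrable_birkhoffMax (hT : MeasurePreserving T μ μ) {g : Ω → ℝ} (hg : Integrable g μ)
    (n : ℕ) : Integrable (birkhoffMax T g n) μ := by
  induction n with
  | zero => exact integrable_zero _ _ _
  | succ n ih => exact ih.sup (integrable_birkhoffSum hT hg _)

theorem measurable_birkhoffMax (hT : Measurable T) {g : Ω → ℝ} (hg : Measurable g)
    (n : ℕ) : Measurable (birkhoffMax T g n) := by
  induction n with
  | zero => exact measurable_const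
  | succ n ih =>
    exact ih.sup (Finset.measurable_sum _ fun k _ => hg.comp (hT.iterate k))

/-- The maximal ergodic theorem. -/
theorem setIntegral_birkhoffMax_pos_nonneg (hT : MeasurePreserving T μ μ) {g : Ω → ℝ}
    (hgm : Measurable g) (hg : Integrable g μ) (n : ℕ) :
    0 ≤ ∫ ω in {ω | 0 < birkhoffMax T g n ω}, g ω ∂μ := by
  set M := birkhoffMax T g n with hM
  have hMi : Integrable M μ := integrable_birkhoffMax hT hg n
  have hMm : Measurable M := measurable_birkhoffMax hT.measurable hgm n
  have hMT : Integrable (M ∘ T) μ := hT.integrable_comp_of_integrable hMi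
  have hM0 (ω) : 0 ≤ M ω := birkhoffSum_le_birkhoffMax T g (Nat.zero_le n) ω
  have hA : MeasurableSet {ω | 0 < M ω} := measurableSet_lt measurable_const hMm
  -- Where the maximum is positive it is attained at a nonempty sum, which is `g ω` plus a shorter
  -- sum started at `T ω`, and the latter is at most `M (T ω)`.
  have h1 : ∀ ω ∈ {ω | 0 < M ω}, M ω - (M ∘ T) ω ≤ g ω := by
    intro ω hω
    obtain ⟨m, hm, h⟩ := exists_birkhoffMax_eq T g n ω
    cases m with
    | zero =>
      have : M ω = 0 := by rw [hM, h, birkhoffSum_zero]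
      exact absurd this (ne_of_gt hω)
    | succ m =>
      have := birkhoffSum_le_birkhoffMax T g (show m ≤ n by omega) (T ω)
      simp only [hM, h, birkhoffSum_succ', Function.comp]
      linarith
  have h2 := setIntegral_mono_on (hMi.sub hMT).integrableOn hg.integrableOn hA h1
  refine le_trans ?_ h2
  simp only [Pi.sub_apply]
  rw [integral_sub hMi.integrableOn hMT.integrableOn]
  have h3 : ∫ ω in {ω | 0 < M ω}, M ω ∂μ = ∫ ω, M ω ∂μ := by
    refine setIntegral_eq_integral_of_forall_compl_eq_zero fun ω hω => ?_
    exact le_antisymm (not_lt.1 hω) (hM0 ω)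
  have h4 : ∫ ω in {ω | 0 < M ω}, (M ∘ T) ω ∂μ ≤ ∫ ω, (M ∘ T) ω ∂μ :=
    setIntegral_le_integral hMT (ae_of_all _ fun ω => hM0 _)
  have h5 : ∫ ω, (M ∘ T) ω ∂μ = ∫ ω, M ω ∂μ := by
    conv_rhs => rw [← hT.map_eq]
    rw [integral_map_of_stronglyMeasurable hT.measurable hMm.stronglyMeasurable]
    rfl
  linarith

/-- The maximal ergodic theorem for `g - α` reads `α μ(A) ≤ ∫_A g`, and `∫_A g ≤ ∫ g` since `g ≥ 0`.
-/
theorem measure_birkhoffMax_sub_const_pos_le [IsFiniteMeasure μ] (hT : MeasurePreserving T μ μ)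
    {g : Ω → ℝ} (hgm : Measurable g) (hg : Integrable g μ) (hg0 : ∀ ω, 0 ≤ g ω) {α : ℝ}
    (hα : 0 < α) (n : ℕ) :
    μ {ω | 0 < birkhoffMax T (fun ω => g ω - α) n ω} ≤ ENNReal.ofReal ((∫ ω, g ω ∂μ) / α) := by
  set A := {ω | 0 < birkhoffMax T (fun ω => g ω - α) n ω} with hA
  have h1 := setIntegral_birkhoffMax_pos_nonneg hT (hgm.sub_const α)
    (hg.sub (integrable_const α)) n
  rw [integral_sub hg.integrableOn (integrable_const α), setIntegral_const, smul_eq_mul] at h1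
  have h2 : ∫ ω in A, g ω ∂μ ≤ ∫ ω, g ω ∂μ := setIntegral_le_integral hg (ae_of_all _ hg0)
  have h3 : μ.real A ≤ (∫ ω, g ω ∂μ) / α := by
    rw [le_div_iff₀ hα]
    linarith
  rw [← ENNReal.ofReal_toReal (measure_ne_top μ A)]
  exact ENNReal.ofReal_le_ofReal h3

/-- The weak type inequality for ergodic averages. -/
theorem measure_exists_lt_birkhoffSum_le [IsFiniteMeasure μ] (hT : MeasurePreserving T μ μ)
    {h : Ω → ℝ≥0∞} (hm : Measurable h) (hfin : ∫⁻ ω, h ω ∂μ ≠ ∞) {α : ℝ≥0} (hα : 0 < α) :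
    μ {ω | ∃ n : ℕ, (n : ℝ≥0∞) * α < birkhoffSum T h n ω} ≤ (∫⁻ ω, h ω ∂μ) / α := by
  set g : Ω → ℝ := fun ω => (h ω).toReal with hg
  have hgm : Measurable g := hm.ennreal_toReal
  have hgi : Integrable g μ := integrable_toReal_of_lintegral_ne_top hm.aemeasurable hfin
  have hg0 (ω) : 0 ≤ g ω := ENNReal.toReal_nonneg
  have htop : ∀ᵐ ω ∂μ, h ω < ∞ := ae_lt_top hm hfin
  have htopk : ∀ᵐ ω ∂μ, ∀ k : ℕ, h (T^[k] ω) < ∞ :=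
    ae_all_iff.2 fun k => (hT.iterate k).quasiMeasurePreserving.ae htop
  have hval : ENNReal.ofReal ((∫ ω, g ω ∂μ) / α) = (∫⁻ ω, h ω ∂μ) / α := by
    rw [ENNReal.ofReal_div_of_pos (by exact_mod_cast hα), ENNReal.ofReal_coe_nnreal,
      integral_toReal hm.aemeasurable htop, ENNReal.ofReal_toReal hfin]
  have hsub : {ω | ∃ n : ℕ, (n : ℝ≥0∞) * α < birkhoffSum T h n ω} ≤ᵐ[μ]
      ⋃ n, {ω | 0 < birkhoffMax T (fun ω => g ω - α) n ω} := by
    filter_upwards [htopk] with ω hω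
    rintro ⟨n, hn⟩
    refine Set.mem_iUnion.2 ⟨n, lt_of_lt_of_le ?_ (birkhoffSum_le_birkhoffMax T _ le_rfl ω)⟩
    have e1 : birkhoffSum T h n ω = ENNReal.ofReal (birkhoffSum T g n ω) := by
      rw [birkhoffSum, birkhoffSum, ENNReal.ofReal_sum_of_nonneg fun k _ => hg0 _]
      exact Finset.sum_congr rfl fun k _ => (ENNReal.ofReal_toReal (hω k).ne).symm
    have e2 : birkhoffSum T (fun ω => g ω - α) n ω = birkhoffSum T g n ω - n * α := by
      simp [birkhoffSum, Finset.sum_sub_distrib]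
    rw [e2, sub_pos]
    rw [e1, ← ENNReal.ofReal_coe_nnreal, ← ENNReal.ofReal_natCast,
      ← ENNReal.ofReal_mul (Nat.cast_nonneg n)] at hn
    exact lt_of_not_ge fun hle => (not_le.2 hn) (ENNReal.ofReal_le_ofReal hle)
  refine (measure_mono_ae hsub).trans ?_
  rw [Monotone.measure_iUnion]
  · refine iSup_le fun n => ?_
    rw [← hval]
    exact measure_birkhoffMax_sub_const_pos_le hT hgm hgi hg0 (by exact_mod_cast hα) n
  · refine monotone_nat_of_le_succ fun n ω hω => ?_
    have h1 : 0 < birkhoffMax T (fun ω => g ω - α) n ω := hω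
    exact h1.trans_le le_sup_left

end MaximalErgodic

/-! ### Decreasing weights against averages -/

section WeightedSums

/-- Summation by parts: subtracting the last weight from all of them shortens the sum, and the
constant part is controlled by the full average. -/
theorem ENNReal.sum_mul_le_of_antitone {m : ℕ → ℝ≥0∞} (hm : Antitone m) (g : ℕ → ℝ≥0∞)
    (M : ℝ≥0∞) (n : ℕ) (hM : ∀ k ≤ n, ∑ i ∈ Finset.range k, g i ≤ k * M) :
    ∑ k ∈ Finset.range n, m k * g k ≤ (∑ k ∈ Finset.range n, m k) * M := by
  induction n generalizing m with
  | zero => simp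
  | succ n ih =>
    have hdec (k) (hk : k ∈ Finset.range (n + 1)) : m k = (m k - m n) + m n :=
      (tsub_add_cancel_of_le (hm (Nat.lt_succ_iff.1 (Finset.mem_range.1 hk)))).symm
    have h1 := ih (m := fun k => m k - m n) (fun i j hij => tsub_le_tsub_right (hm hij) _)
      fun k hk => hM k (by omega)
    calc ∑ k ∈ Finset.range (n + 1), m k * g k
        = ∑ k ∈ Finset.range (n + 1), ((m k - m n) * g k + m n * g k) :=
          Finset.sum_congr rfl fun k hk => by rw [← add_mul, ← hdec k hk]
      _ = ∑ k ∈ Finset.range n, (m k - m n) * g k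
            + m n * ∑ k ∈ Finset.range (n + 1), g k := by
          rw [Finset.sum_add_distrib, ← Finset.mul_sum, Finset.sum_range_succ (fun k =>
            (m k - m n) * g k)]
          simp
      _ ≤ (∑ k ∈ Finset.range n, (m k - m n)) * M + m n * ((n + 1 : ℕ) * M) := by
          gcongr
          exact hM _ le_rfl
      _ = (∑ k ∈ Finset.range (n + 1), ((m k - m n) + m n)) * M := by
          rw [Finset.sum_add_distrib, Finset.sum_range_succ (fun k => m k - m n)]
          simp only [tsub_self, add_zero, Finset.sum_const, Finset.card_range, nsmul_eq_mul]
          ring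
      _ = _ := by rw [← Finset.sum_congr rfl hdec]

/-- An integral over a half-line against a decreasing step weight is controlled by the averages
over the intervals `[0, n]`. -/
theorem setLIntegral_Ici_mul_le {φ w : ℝ → ℝ≥0∞} {m : ℕ → ℝ≥0∞} (hm : Antitone m)
    (hmtop : ∀ k, m k ≠ ∞)
    (hw : ∀ (k : ℕ) (t : ℝ), (k : ℝ) ≤ t → w t ≤ m k) {M S : ℝ≥0∞}
    (hM : ∀ n : ℕ, ∑ k ∈ Finset.range n, ∫⁻ t in Set.Ico (k : ℝ) (k + 1), φ t ≤ n * M)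
    (hS : ∀ n, ∑ k ∈ Finset.range n, m k ≤ S) :
    ∫⁻ t in Set.Ici 0, φ t * w t ≤ S * M := by
  have hcover : Set.Ici (0 : ℝ) ⊆ ⋃ k : ℕ, Set.Ico (k : ℝ) (k + 1) := fun t ht =>
    Set.mem_iUnion.2 ⟨⌊t⌋₊, Nat.floor_le ht, Nat.lt_floor_add_one t⟩
  calc ∫⁻ t in Set.Ici 0, φ t * w t
      ≤ ∫⁻ t in ⋃ k : ℕ, Set.Ico (k : ℝ) (k + 1), φ t * w t := lintegral_mono_set hcover
    _ ≤ ∑' k : ℕ, ∫⁻ t in Set.Ico (k : ℝ) (k + 1), φ t * w t := lintegral_iUnion_le _ _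
    _ ≤ ∑' k : ℕ, m k * ∫⁻ t in Set.Ico (k : ℝ) (k + 1), φ t := by
        refine ENNReal.tsum_le_tsum fun k => ?_
        rw [← lintegral_const_mul' _ _ (hmtop k)]
        refine setLIntegral_mono' measurableSet_Ico fun t ht => ?_
        rw [mul_comm]
        gcongr
        exact hw k t ht.1
    _ ≤ S * M := by
        rw [ENNReal.tsum_eq_iSup_nat]
        refine iSup_le fun n => ?_
        refine (ENNReal.sum_mul_le_of_antitone hm _ M n fun k _ => hM k).trans ?_
        gcongr
        exact hS n

/-- The two terms of the minimum cross near `k = D`. Up to `⌈D⌉` the harmonic sum gives `1 + log (1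
+ D)`, and beyond it the quadratic tail gives at most `2`. Later `D` is proportional to the inverse
gap, so this is the source of the logarithm. -/
theorem sum_min_inv_le (D : ℝ) (hD : 0 ≤ D) (n : ℕ) :
    ∑ k ∈ Finset.range n, min (1 / ((k : ℝ) + 1)) (D / ((k : ℝ) + 1) ^ 2) ≤ 3 + Real.log (1 + D) := by
  set N := ⌈D⌉₊ with hN
  have hDN : D ≤ N := Nat.le_ceil D
  have hpos (k : ℕ) : 0 ≤ min (1 / ((k : ℝ) + 1)) (D / ((k : ℝ) + 1) ^ 2) := by positivity
  have h1 : ∑ k ∈ Finset.range N, min (1 / ((k : ℝ) + 1)) (D / ((k : ℝ) + 1) ^ 2)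
      ≤ 1 + Real.log (1 + D) := by
    calc _ ≤ ∑ k ∈ Finset.range N, 1 / ((k : ℝ) + 1) :=
          Finset.sum_le_sum fun k _ => min_le_left _ _
      _ = (harmonic N : ℝ) := by simp [harmonic]
      _ ≤ 1 + Real.log N := harmonic_le_one_add_log N
      _ ≤ 1 + Real.log (1 + D) := by
          rcases Nat.eq_zero_or_pos N with h0 | h0
          · rw [h0]
            simpa using Real.log_nonneg (by linarith)
          · have : (N : ℝ) ≤ 1 + D := by linarith [Nat.ceil_lt_add_one hD]
            gcongr
  have h2 : ∑ k ∈ Finset.Ico N (max n N), min (1 / ((k : ℝ) + 1)) (D / ((k : ℝ) + 1) ^ 2) ≤ 2 := by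
    calc _ ≤ ∑ k ∈ Finset.Ico N (max n N), D * (((k + 1 : ℕ) : ℝ) ^ 2)⁻¹ := by
          refine Finset.sum_le_sum fun k _ => (min_le_right _ _).trans (le_of_eq ?_)
          push_cast
          rw [div_eq_mul_inv]
      _ = D * ∑ i ∈ Finset.Ioo N (max n N + 1), ((i : ℝ) ^ 2)⁻¹ := by
          rw [← Finset.mul_sum, Finset.sum_Ico_add' (fun i : ℕ => ((i : ℝ) ^ 2)⁻¹)]
          congr 2
      _ ≤ D * (2 / (N + 1)) := by
          gcongr
          exact sum_Ioo_inv_sq_le N _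
      _ ≤ 2 := by
          rw [← mul_div_assoc, div_le_iff₀ (by positivity)]
          linarith
  calc _ ≤ ∑ k ∈ Finset.range (max n N), min (1 / ((k : ℝ) + 1)) (D / ((k : ℝ) + 1) ^ 2) :=
        Finset.sum_le_sum_of_subset_of_nonneg
          (Finset.range_subset_range.2 (le_max_left _ _)) fun k _ _ => hpos k
    _ ≤ _ := by
        rw [← Finset.sum_range_add_sum_Ico _ (le_max_right n N)]
        linarith

end WeightedSums

/-! ### Kernel integrals bounded by averages, and Landau's condition -/

section KernelEstimates

open Complex (I)

theorem lintegral_mul_le_of_antitone {φ w : ℝ → ℝ≥0∞} {m : ℕ → ℝ≥0∞} (hm : Antitone m)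
    (hmtop : ∀ k, m k ≠ ∞) (hw : ∀ (k : ℕ) (t : ℝ), (k : ℝ) ≤ |t| → w t ≤ m k)
    {M₁ M₂ S : ℝ≥0∞}
    (hM₁ : ∀ n : ℕ, ∑ k ∈ Finset.range n, ∫⁻ t in Set.Ico (k : ℝ) (k + 1), φ t ≤ n * M₁)
    (hM₂ : ∀ n : ℕ, ∑ k ∈ Finset.range n, ∫⁻ t in Set.Ico (k : ℝ) (k + 1), φ (-t) ≤ n * M₂)
    (hS : ∀ n, ∑ k ∈ Finset.range n, m k ≤ S) :
    ∫⁻ t, φ t * w t ≤ S * (M₁ + M₂) := by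
  have h1 := setLIntegral_Ici_mul_le hm hmtop
    (fun k t hk => hw k t (hk.trans (le_abs_self t))) hM₁ hS
  have h2 := setLIntegral_Ici_mul_le (φ := fun t => φ (-t)) (w := fun t => w (-t)) hm hmtop
    (fun k t hk => hw k (-t) (by rw [abs_neg]; exact hk.trans (le_abs_self t))) hM₂ hS
  have h3 : ∫⁻ t in Set.Iic 0, φ t * w t = ∫⁻ t in Set.Ici 0, φ (-t) * w (-t) := by
    have := (Measure.measurePreserving_neg (volume : Measure ℝ)).setLIntegral_comp_preimage_emb
      (Homeomorph.neg ℝ).measurableEmbedding (fun t => φ t * w t) (Set.Iic 0)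
    rw [← this]
    simp
  calc ∫⁻ t, φ t * w t = ∫⁻ t in Set.Ici 0 ∪ Set.Iic 0, φ t * w t := by
        rw [Set.union_comm, Set.Iic_union_Ici, setLIntegral_univ]
    _ ≤ _ := lintegral_union_le _ _ _
    _ ≤ S * M₁ + S * M₂ := by rw [h3]; exact add_le_add h1 h2
    _ = _ := (mul_add _ _ _).symm

/-- Both `u` and `|t|` are at most `|u + it|`, hence `(1 + u)|u + it| ≥ u + uk`. This turns the
kernel bounds into step weights on unit intervals, so averages at scales below `1` are never needed.
-/
theorem mul_add_one_le_norm_add_I_mul {u : ℝ} (hu : 0 < u) {k t : ℝ} (hk : k ≤ |t|) :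
    u / (1 + u) * (k + 1) ≤ ‖(u : ℂ) + I * t‖ := by
  have h1 : u ≤ ‖(u : ℂ) + I * t‖ := by
    have := Complex.abs_re_le_norm ((u : ℂ) + I * t)
    simpa [abs_of_pos hu] using this
  have h2 : |t| ≤ ‖(u : ℂ) + I * t‖ := by
    have := Complex.abs_im_le_norm ((u : ℂ) + I * t)
    simpa using this
  rw [div_mul_eq_mul_div, div_le_iff₀ (by positivity)]
  nlinarith

theorem lintegral_mul_poissonKernelReal_le {u : ℝ} (hu : 0 < u) :
    ∃ B : ℝ≥0, ∀ (φ : ℝ → ℝ≥0∞) (M₁ M₂ : ℝ≥0∞),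
      (∀ n : ℕ, ∑ k ∈ Finset.range n, ∫⁻ t in Set.Ico (k : ℝ) (k + 1), φ t ≤ n * M₁) →
      (∀ n : ℕ, ∑ k ∈ Finset.range n, ∫⁻ t in Set.Ico (k : ℝ) (k + 1), φ (-t) ≤ n * M₂) →
      ∫⁻ t, φ t * ‖poissonKernelReal u t‖ₑ ≤ B * (M₁ + M₂) := by
  set c := u / (1 + u) with hc
  have hc0 : 0 < c := by positivity
  set A := 1 / Real.pi * u / c ^ 2 with hA
  have hA0 : 0 ≤ A := by positivity
  refine ⟨(A * 2).toNNReal, fun φ M₁ M₂ h1 h2 => ?_⟩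
  refine lintegral_mul_le_of_antitone (m := fun k : ℕ => ENNReal.ofReal (A * (((k + 1 : ℕ) : ℝ) ^ 2)⁻¹))
    ?_ (fun k => ENNReal.ofReal_ne_top) (fun k t hk => ?_) h1 h2 (fun n => ?_)
  · intro i j hij
    refine ENNReal.ofReal_le_ofReal ?_
    gcongr
  · rw [← ofReal_norm]
    refine ENNReal.ofReal_le_ofReal ?_
    have h3 := mul_add_one_le_norm_add_I_mul hu hk
    rw [← hc] at h3
    have h4 : (c * (k + 1)) ^ 2 ≤ u ^ 2 + t ^ 2 := by
      rw [← sq_norm_add_I_mul]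
      gcongr
    rw [poissonKernelReal, Real.norm_of_nonneg (by positivity)]
    calc 1 / Real.pi * (u / (u ^ 2 + t ^ 2)) ≤ 1 / Real.pi * (u / (c * (k + 1)) ^ 2) := by gcongr
      _ = _ := by rw [hA]; push_cast; field_simp
  · rw [← ENNReal.ofReal_sum_of_nonneg fun k _ => by positivity, ENNReal.ofNNReal_toNNReal]
    refine ENNReal.ofReal_le_ofReal ?_
    rw [← Finset.mul_sum]
    gcongr
    have := sum_Ioo_inv_sq_le (α := ℝ) 0 (n + 1)
    rw [Finset.range_eq_Ico, Finset.sum_Ico_add' (fun i : ℕ => ((i : ℝ) ^ 2)⁻¹)]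
    exact this.trans (by norm_num)

/-- With `c = u / (1 + u)`, the linear and quadratic bounds become `A / (k + 1)` and `A D / (k +
1)²`, where `A = e^{-ua} / c` and `D = 1 / (c (b - a))`. The weight is their minimum. -/
theorem lintegral_mul_truncKernel_le {a b u : ℝ} (hab : a < b) (hu : 0 < u) (φ : ℝ → ℝ≥0∞)
    (M₁ M₂ : ℝ≥0∞)
    (h1 : ∀ n : ℕ, ∑ k ∈ Finset.range n, ∫⁻ t in Set.Ico (k : ℝ) (k + 1), φ t ≤ n * M₁)
    (h2 : ∀ n : ℕ, ∑ k ∈ Finset.range n, ∫⁻ t in Set.Ico (k : ℝ) (k + 1), φ (-t) ≤ n * M₂) :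
    ∫⁻ t, φ t * ‖truncKernel a b u t‖ₑ ≤
      ENNReal.ofReal (Real.exp (-(u * a)) * ((1 + u) / u) *
        (3 + Real.log (1 + (1 + u) / u / (b - a)))) * (M₁ + M₂) := by
  have hd : 0 < b - a := sub_pos.2 hab
  set c := u / (1 + u) with hc
  have hc0 : 0 < c := by positivity
  have hcinv : (1 + u) / u = c⁻¹ := by rw [hc, inv_div]
  rw [hcinv]
  set D := c⁻¹ / (b - a) with hD
  have hD0 : 0 ≤ D := by positivity
  set A := Real.exp (-(u * a)) * c⁻¹ with hA
  have hA0 : 0 ≤ A := by positivity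
  refine lintegral_mul_le_of_antitone (m := fun k : ℕ => ENNReal.ofReal
    (A * min (1 / ((k : ℝ) + 1)) (D / ((k : ℝ) + 1) ^ 2)))
    ?_ (fun k => ENNReal.ofReal_ne_top) (fun k t hk => ?_) h1 h2 (fun n => ?_)
  · intro i j hij
    refine ENNReal.ofReal_le_ofReal ?_
    have : (i : ℝ) ≤ j := by exact_mod_cast hij
    gcongr
  · rw [← ofReal_norm]
    refine ENNReal.ofReal_le_ofReal ?_
    have h3 := mul_add_one_le_norm_add_I_mul hu hk
    rw [← hc] at h3
    have hk1 : 0 < c * ((k : ℝ) + 1) := by positivity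
    rw [mul_min_of_nonneg _ _ hA0, le_min_iff]
    constructor
    · refine (norm_truncKernel_le_linear hab hu t).trans ?_
      calc _ ≤ Real.exp (-(u * a)) * (c * ((k : ℝ) + 1))⁻¹ := by gcongr
        _ = _ := by rw [hA]; field_simp
    · refine (norm_truncKernel_le_quadratic hab hu t).trans ?_
      have h4 : (c * (k + 1)) ^ 2 ≤ u ^ 2 + t ^ 2 := by
        rw [← sq_norm_add_I_mul]
        gcongr
      calc _ ≤ Real.exp (-(u * a)) * ((b - a)⁻¹ * ((c * ((k : ℝ) + 1)) ^ 2)⁻¹) := by gcongr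
        _ = _ := by rw [hA, hD]; field_simp
  · rw [← ENNReal.ofReal_sum_of_nonneg fun k _ => by positivity]
    refine ENNReal.ofReal_le_ofReal ?_
    rw [← Finset.mul_sum]
    gcongr
    exact sum_min_inv_le D hD0 n

/-- Under Landau's condition the logarithm of the gaps is absorbed by the exponential factor. -/
theorem LandauCondition.exists_exp_mul_log_le {lam : ℕ → ℝ} (hlam : IsFrequency lam)
    (hLC : LandauCondition lam) {u : ℝ} (hu : 0 < u) :
    ∃ B : ℝ, 0 ≤ B ∧ ∀ N, Real.exp (-(u * lam N)) * ((1 + u) / u) *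
        (3 + Real.log (1 + (1 + u) / u / (lam (N + 1) - lam N))) ≤
          B * Real.exp (-(u / 2 * lam N)) := by
  -- With `δ = u / 2` the logarithm of the inverse gap grows at most like `x = e^{uλ_N/2}`. One
  -- factor `x⁻¹` taken from `e^{-uλ_N}` absorbs it, and the factor `e^{-uλ_N/2}` remains.
  obtain ⟨C, hC, hgap⟩ := hLC (u / 2) (half_pos hu)
  set s := (1 + u) / u with hs
  have hs0 : 0 < s := by positivity
  have hlog0 : 0 ≤ Real.log (1 + s / C) := Real.log_nonneg (by
    have : 0 ≤ s / C := by positivity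
    linarith)
  refine ⟨s * (4 + Real.log (1 + s / C)), by positivity, fun N => ?_⟩
  set x := Real.exp (u / 2 * lam N) with hx
  have hx1 : 1 ≤ x := Real.one_le_exp (mul_nonneg (half_pos hu).le (hlam.nonneg N))
  have hE1 : 1 ≤ Real.exp x := Real.one_le_exp (by linarith)
  have hd : 0 < lam (N + 1) - lam N := sub_pos.2 (hlam.strictMono (Nat.lt_succ_self N))
  have h1 : 1 + s / (lam (N + 1) - lam N) ≤ (1 + s / C) * Real.exp x := by
    have h2 : s / (lam (N + 1) - lam N) ≤ s / (C * Real.exp (-x)) := by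
      gcongr
      exact hgap N
    have h3 : s / (C * Real.exp (-x)) = s / C * Real.exp x := by
      rw [Real.exp_neg]
      field_simp
    rw [h3] at h2
    linarith
  have h4 : Real.log (1 + s / (lam (N + 1) - lam N)) ≤ Real.log (1 + s / C) + x := by
    refine (Real.log_le_log (by positivity) h1).trans (le_of_eq ?_)
    rw [Real.log_mul (by positivity) (by positivity), Real.log_exp]
  have h5 : Real.exp (-(u * lam N)) = Real.exp (-(u / 2 * lam N)) * x⁻¹ := by
    rw [hx, ← Real.exp_neg, ← Real.exp_add]
    congr 1
    ring
  have h6 : x⁻¹ * (3 + Real.log (1 + s / (lam (N + 1) - lam N))) ≤ 4 + Real.log (1 + s / C) := by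
    rw [inv_mul_le_iff₀ (by linarith)]
    nlinarith
  rw [h5]
  calc _ = Real.exp (-(u / 2 * lam N)) * s *
        (x⁻¹ * (3 + Real.log (1 + s / (lam (N + 1) - lam N)))) := by ring
    _ ≤ Real.exp (-(u / 2 * lam N)) * s * (4 + Real.log (1 + s / C)) := by gcongr
    _ = _ := by ring

end KernelEstimates

/-! ### Convolution and maximal functions along a flow -/

section Flows

variable {G : Type*} [CommGroup G] [TopologicalSpace G] [IsTopologicalGroup G]
  [MeasurableSpace G] [BorelSpace G]
  {μ : Measure G} [IsProbabilityMeasure μ] [μ.IsMulLeftInvariant] {γ : ℝ → G}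

theorem measurable_mul_flow (hγ : Continuous γ) : Measurable fun p : ℝ × G => p.2 * γ p.1 :=
  (continuous_snd.mul (hγ.comp continuous_fst)).measurable

theorem measurePreserving_flow (hγ : Continuous γ) :
    MeasurePreserving (fun p : ℝ × G => (p.1, p.2 * γ p.1)) ((volume : Measure ℝ).prod μ)
      ((volume : Measure ℝ).prod μ) :=
  (MeasurePreserving.id _).skew_product (g := fun t ω => ω * γ t) (measurable_mul_flow hγ)
    (ae_of_all _ fun t => (measurePreserving_mul_right μ (γ t)).map_eq)

theorem integrable_flow (hγ : Continuous γ) {f : G → ℂ} (hf : Integrable f μ) {K : ℝ → ℂ}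
    (hK : Integrable K) :
    Integrable (fun p : ℝ × G => K p.1 * f (p.2 * γ p.1)) ((volume : Measure ℝ).prod μ) :=
  (measurePreserving_flow hγ).integrable_comp_of_integrable (hK.mul_prod hf)

theorem ae_integrable_flow (hγ : Continuous γ) {f : G → ℂ} (hf : Integrable f μ) {K : ℝ → ℂ}
    (hK : Integrable K) : ∀ᵐ ω ∂μ, Integrable fun t => K t * f (ω * γ t) :=
  (integrable_flow hγ hf hK).prod_left_ae

/-- A single orbit may be a null set, so the property cannot simply be restricted to it. The map
`(t, ω) ↦ (t, ω γ(t))` preserves the product measure, and Fubini gives the claim for almost every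
orbit. -/
theorem ae_ae_flow (hγ : Continuous γ) {p : G → Prop} (hp : ∀ᵐ ω ∂μ, p ω) :
    ∀ᵐ ω ∂μ, ∀ᵐ t : ℝ, p (ω * γ t) := by
  have h1 : ∀ᵐ q ∂(volume : Measure ℝ).prod μ, p q.2 := Measure.quasiMeasurePreserving_snd.ae hp
  have h2 := (measurePreserving_flow (μ := μ) hγ).quasiMeasurePreserving.ae h1
  have h3 := (Measure.measurePreserving_swap (μ := μ) (ν := (volume : Measure ℝ))
    ).quasiMeasurePreserving.ae h2
  exact Measure.ae_ae_of_ae_prod h3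

/-- The Fourier coefficients of a convolution along a flow. -/
theorem groupFourierCoeff_flow (hγ : Continuous γ) {f : G → ℂ} (hf : Integrable f μ) {K : ℝ → ℂ}
    (hK : Integrable K) (χ : PontryaginDual G) :
    groupFourierCoeff μ (fun ω => ∫ t, K t * f (ω * γ t)) χ =
      (∫ t, K t * ((χ (γ t) : Circle) : ℂ)) * groupFourierCoeff μ f χ := by
  have hχc : Continuous fun ω => ((χ ω : Circle) : ℂ) :=
    continuous_subtype_val.comp (map_continuous χ)
  have hcoef (t : ℝ) : ∫ ω, f (ω * γ t) * (starRingEnd ℂ) ((χ ω : Circle) : ℂ) ∂μ =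
      ((χ (γ t) : Circle) : ℂ) * groupFourierCoeff μ f χ := by
    rw [groupFourierCoeff, ← integral_const_mul,
      ← integral_mul_right_eq_self (fun ω => ((χ (γ t) : Circle) : ℂ) *
        (f ω * (starRingEnd ℂ) ((χ ω : Circle) : ℂ))) (γ t)]
    congr 1 with ω : 1
    have h1 : ((χ (γ t) : Circle) : ℂ) * (starRingEnd ℂ) ((χ (γ t) : Circle) : ℂ) = 1 := by
      rw [Complex.mul_conj, Circle.normSq_coe, Complex.ofReal_one]
    rw [map_mul, Circle.coe_mul, map_mul]
    linear_combination -(f (ω * γ t) * (starRingEnd ℂ) ((χ ω : Circle) : ℂ)) * h1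
  have hint : Integrable (fun p : G × ℝ => K p.2 * f (p.1 * γ p.2) *
      (starRingEnd ℂ) ((χ p.1 : Circle) : ℂ)) (μ.prod volume) := by
    refine ((integrable_flow hγ hf hK).swap).mul_bdd (c := 1) ?_ (ae_of_all _ fun p => ?_)
    · exact ((Complex.continuous_conj.comp hχc).measurable.comp measurable_fst).aestronglyMeasurable
    · rw [RCLike.norm_conj, Circle.norm_coe]
  calc groupFourierCoeff μ (fun ω => ∫ t, K t * f (ω * γ t)) χ
      = ∫ ω, (∫ t, K t * f (ω * γ t) * (starRingEnd ℂ) ((χ ω : Circle) : ℂ)) ∂μ := by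
        simp only [groupFourierCoeff, ← integral_mul_const]
    _ = ∫ t, ∫ ω, K t * f (ω * γ t) * (starRingEnd ℂ) ((χ ω : Circle) : ℂ) ∂μ :=
        integral_integral_swap hint
    _ = _ := by
        rw [← integral_mul_const]
        congr 1 with t : 1
        simp only [mul_assoc]
        rw [integral_const_mul, hcoef]

/-- The one-sided maximal function, at large scales, along a flow. -/
noncomputable def flowMax (γ : ℝ → G) (h : G → ℝ≥0∞) (ω : G) : ℝ≥0∞ :=
  ⨆ n : ℕ, (∑ k ∈ Finset.range n, ∫⁻ t in Set.Ico (k : ℝ) (k + 1), h (ω * γ t)) / n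

theorem sum_le_mul_flowMax (γ : ℝ → G) (h : G → ℝ≥0∞) (ω : G) (n : ℕ) :
    ∑ k ∈ Finset.range n, ∫⁻ t in Set.Ico (k : ℝ) (k + 1), h (ω * γ t) ≤ n * flowMax γ h ω := by
  rcases Nat.eq_zero_or_pos n with rfl | hn
  · simp
  · rw [← ENNReal.div_le_iff' (by positivity) (ENNReal.natCast_ne_top n)]
    exact le_iSup (fun n : ℕ =>
      (∑ k ∈ Finset.range n, ∫⁻ t in Set.Ico (k : ℝ) (k + 1), h (ω * γ t)) / n) n

/-- This turns integrals over `[0, n)` along the flow into Birkhoff sums, for translation by `γ 1`,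
of the integral over unit time. -/
theorem setLIntegral_flow_eq_iterate (hmul : ∀ s t, γ (s + t) = γ s * γ t) (h : G → ℝ≥0∞) (ω : G)
    (k : ℕ) : ∫⁻ t in Set.Ico (k : ℝ) (k + 1), h (ω * γ t) =
      ∫⁻ t in Set.Ico (0 : ℝ) 1, h ((fun x => x * γ 1)^[k] ω * γ t) := by
  have hiter (k : ℕ) : (fun x => x * γ 1)^[k] ω = ω * γ k := by
    induction k with
    | zero =>
      have h0 := hmul 0 0
      rw [add_zero] at h0
      simp [left_eq_mul.1 h0]
    | succ k ih =>
      rw [Function.iterate_succ_apply', ih, Nat.cast_succ, hmul, mul_assoc]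
  have h1 := (measurePreserving_add_right (volume : Measure ℝ) (k : ℝ)).setLIntegral_comp_preimage_emb
    (Homeomorph.addRight (k : ℝ)).measurableEmbedding (fun t => h (ω * γ t))
    (Set.Ico (k : ℝ) (k + 1))
  rw [← h1]
  have h2 : (fun x : ℝ => x + k) ⁻¹' Set.Ico (k : ℝ) (k + 1) = Set.Ico 0 1 := by
    ext x
    simp
  rw [h2, hiter]
  refine lintegral_congr fun t => ?_
  rw [add_comm t, hmul, mul_assoc]

theorem lintegral_lintegral_flow (hγ : Continuous γ) {h : G → ℝ≥0∞} (hh : Measurable h) :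
    ∫⁻ ω, (∫⁻ t in Set.Ico (0 : ℝ) 1, h (ω * γ t)) ∂μ = ∫⁻ ω, h ω ∂μ := by
  rw [lintegral_lintegral_swap]
  · have (t : ℝ) : ∫⁻ ω, h (ω * γ t) ∂μ = ∫⁻ ω, h ω ∂μ := lintegral_mul_right_eq_self h (γ t)
    simp [this]
  · exact (hh.comp ((measurable_mul_flow hγ).comp measurable_swap)).aemeasurable

theorem measurable_setLIntegral_flow (hγ : Continuous γ) {h : G → ℝ≥0∞} (hh : Measurable h) :
    Measurable fun ω => ∫⁻ t in Set.Ico (0 : ℝ) 1, h (ω * γ t) :=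
  Measurable.lintegral_prod_right' (f := fun p : G × ℝ => h (p.1 * γ p.2))
    (hh.comp ((measurable_mul_flow hγ).comp measurable_swap))

theorem measure_lt_flowMax_le_of_measurable (hγ : Continuous γ)
    (hmul : ∀ s t, γ (s + t) = γ s * γ t) {h : G → ℝ≥0∞} (hh : Measurable h)
    (hfin : ∫⁻ ω, h ω ∂μ ≠ ∞) {α : ℝ≥0} (hα : 0 < α) :
    μ {ω | (α : ℝ≥0∞) < flowMax γ h ω} ≤ (∫⁻ ω, h ω ∂μ) / α := by
  set h₁ : G → ℝ≥0∞ := fun ω => ∫⁻ t in Set.Ico (0 : ℝ) 1, h (ω * γ t) with hh₁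
  have hint : ∫⁻ ω, h₁ ω ∂μ = ∫⁻ ω, h ω ∂μ := lintegral_lintegral_flow hγ hh
  have key := measure_exists_lt_birkhoffSum_le (measurePreserving_mul_right μ (γ 1))
    (measurable_setLIntegral_flow hγ hh) (by rw [hint]; exact hfin) hα
  rw [hint] at key
  refine le_trans (measure_mono fun ω hω => ?_) key
  obtain ⟨n, hn⟩ := lt_iSup_iff.1 (show (α : ℝ≥0∞) < flowMax γ h ω from hω)
  refine ⟨n, ?_⟩
  -- The term `n = 0` of the supremum is `0 / 0 = 0` and cannot exceed `α`.
  rcases Nat.eq_zero_or_pos n with rfl | hn0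
  · simp at hn
  rw [ENNReal.lt_div_iff_mul_lt (Or.inl (by positivity)) (Or.inl (ENNReal.natCast_ne_top n)),
    mul_comm] at hn
  simpa only [setLIntegral_flow_eq_iterate hmul, birkhoffSum] using hn

/-- The weak type inequality for the maximal function along a flow. -/
theorem measure_lt_flowMax_le (hγ : Continuous γ) (hmul : ∀ s t, γ (s + t) = γ s * γ t)
    {h : G → ℝ≥0∞} (hh : AEMeasurable h μ) (hfin : ∫⁻ ω, h ω ∂μ ≠ ∞) {α : ℝ≥0} (hα : 0 < α) :
    μ {ω | (α : ℝ≥0∞) < flowMax γ h ω} ≤ (∫⁻ ω, h ω ∂μ) / α := by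
  have hae : ∀ᵐ ω ∂μ, flowMax γ h ω = flowMax γ (hh.mk h) ω := by
    filter_upwards [ae_ae_flow hγ hh.ae_eq_mk] with ω hω
    simp only [flowMax]
    congr 1 with n : 1
    congr 1
    exact Finset.sum_congr rfl fun k _ => lintegral_congr_ae (ae_restrict_of_ae hω)
  rw [lintegral_congr_ae hh.ae_eq_mk] at hfin ⊢
  refine le_trans (measure_mono_ae ?_)
    (measure_lt_flowMax_le_of_measurable hγ hmul hh.measurable_mk hfin hα)
  filter_upwards [hae] with ω hω (h1 : (α : ℝ≥0∞) < flowMax γ h ω)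
  exact h1.trans_eq hω

/-- The set where the maximal function is infinite lies in every superlevel set, and the weak type
bound tends to `0` as the level grows. -/
theorem ae_flowMax_lt_top (hγ : Continuous γ) (hmul : ∀ s t, γ (s + t) = γ s * γ t)
    {h : G → ℝ≥0∞} (hh : AEMeasurable h μ) (hfin : ∫⁻ ω, h ω ∂μ ≠ ∞) :
    ∀ᵐ ω ∂μ, flowMax γ h ω < ∞ := by
  have h1 (n : ℕ) : μ {ω | ¬ flowMax γ h ω < ∞} ≤ (∫⁻ ω, h ω ∂μ) / ((n + 1 : ℕ) : ℝ≥0) := by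
    refine le_trans (measure_mono fun ω hω => ?_)
      (measure_lt_flowMax_le hγ hmul hh hfin (α := (n + 1 : ℕ)) (by positivity))
    have : flowMax γ h ω = ∞ := not_lt_top_iff.1 hω
    simp [this]
  have h2 : Tendsto (fun n : ℕ => (∫⁻ ω, h ω ∂μ) / ((n + 1 : ℕ) : ℝ≥0)) atTop (𝓝 0) := by
    have h3 := ENNReal.Tendsto.const_mul (a := ∫⁻ ω, h ω ∂μ)
      (ENNReal.tendsto_inv_nat_nhds_zero.comp (tendsto_add_atTop_nat 1)) (Or.inr hfin)
    rw [mul_zero] at h3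
    exact h3
  exact le_antisymm (ge_of_tendsto' h2 h1) zero_le

end Flows

/-! ### Partial sums as convolutions with cutoff kernels -/

section Identity

open Complex (I)

variable {G : Type*} [CommGroup G] [TopologicalSpace G] [IsTopologicalGroup G]
  [CompactSpace G] [T2Space G] [MeasurableSpace G] [BorelSpace G]
  {μ : Measure G} [μ.IsHaarMeasure] [μ.Regular] [IsProbabilityMeasure μ]
  {lam : ℕ → ℝ} {β : Multiplicative ℝ →ₜ* G}

theorem PontryaginDual.continuous_coe (χ : PontryaginDual G) :
    Continuous fun ω => ((χ ω : Circle) : ℂ) :=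
  continuous_subtype_val.comp (map_continuous χ)

theorem PontryaginDual.integral_coe_eq_zero {χ : PontryaginDual G} (hχ : χ ≠ 1) :
    ∫ ω, ((χ ω : Circle) : ℂ) ∂μ = 0 := by
  obtain ⟨g, hg⟩ := DFunLike.ne_iff.1 hχ
  have hmul (ω : G) : ((χ (g * ω) : Circle) : ℂ) = ((χ g : Circle) : ℂ) * ((χ ω : Circle) : ℂ) :=
    congrArg Subtype.val (_root_.map_mul χ g ω)
  have h1 : ∫ ω, ((χ (g * ω) : Circle) : ℂ) ∂μ = ∫ ω, ((χ ω : Circle) : ℂ) ∂μ :=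
    integral_mul_left_eq_self (fun ω => ((χ ω : Circle) : ℂ)) g
  rw [integral_congr_ae (ae_of_all _ hmul), integral_const_mul] at h1
  have h2 : ((χ g : Circle) : ℂ) ≠ 1 := fun e => hg (Subtype.ext e)
  have h3 : (((χ g : Circle) : ℂ) - 1) * ∫ ω, ((χ ω : Circle) : ℂ) ∂μ = 0 := by
    linear_combination h1
  exact (mul_eq_zero.1 h3).resolve_left (sub_ne_zero.2 h2)

open Classical in
/-- Orthogonality of characters. -/
theorem groupFourierCoeff_char (χ ψ : PontryaginDual G) :
    groupFourierCoeff μ (fun ω => ((χ ω : Circle) : ℂ)) ψ = if χ = ψ then 1 else 0 := by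
  have h1 (ω : G) : ((χ ω : Circle) : ℂ) * (starRingEnd ℂ) ((ψ ω : Circle) : ℂ) =
      (((χ * ψ⁻¹) ω : Circle) : ℂ) := by
    rw [← PontryaginDual.coe_inv_apply]
    rfl
  simp only [groupFourierCoeff, h1]
  split_ifs with h
  · subst h
    simp
  · exact PontryaginDual.integral_coe_eq_zero fun e => h (mul_inv_eq_one.1 e)

open Classical in
theorem groupFourierCoeff_sum (s : Finset ℕ) (c : ℕ → ℂ) (χ : ℕ → PontryaginDual G)
    (ψ : PontryaginDual G) :
    groupFourierCoeff μ (fun ω => ∑ n ∈ s, c n * ((χ n ω : Circle) : ℂ)) ψ =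
      ∑ n ∈ s, c n * if χ n = ψ then 1 else 0 := by
  have hi (n : ℕ) : Integrable (fun ω => c n * ((χ n ω : Circle) : ℂ) *
      (starRingEnd ℂ) ((ψ ω : Circle) : ℂ)) μ :=
    ((continuous_const.mul (χ n).continuous_coe).mul
      (Complex.continuous_conj.comp ψ.continuous_coe)).integrable_of_hasCompactSupport
      (HasCompactSupport.of_compactSpace _)
  simp only [← groupFourierCoeff_char (μ := μ), groupFourierCoeff, Finset.sum_mul]
  rw [integral_finsetSum _ fun n _ => hi n]
  refine Finset.sum_congr rfl fun n _ => ?_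
  rw [← integral_const_mul]
  simp only [mul_assoc]

theorem IsDirichletGroup.char_injective (hlam : IsFrequency lam) (hG : IsDirichletGroup lam β) :
    Function.Injective hG.char := by
  intro n m hnm
  have h (t : ℝ) : Complex.exp (-(I * (lam n : ℂ) * (t : ℂ))) =
      Complex.exp (-(I * (lam m : ℂ) * (t : ℂ))) := by
    rw [← hG.char_spec n t, ← hG.char_spec m t, hnm]
  by_contra hne
  have hlne : lam n - lam m ≠ 0 := sub_ne_zero.2 fun e => hne (hlam.strictMono.injective e)
  -- At this time the two exponentials differ by the factor `-1`.
  have h1 := h (Real.pi / (lam n - lam m))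
  rw [← sub_eq_zero] at h1
  have h2 : Complex.exp (-(I * (lam n : ℂ) * ((Real.pi / (lam n - lam m) : ℝ) : ℂ))) =
      Complex.exp (-(I * (lam m : ℂ) * ((Real.pi / (lam n - lam m) : ℝ) : ℂ))) * -1 := by
    rw [← Complex.exp_neg_pi_mul_I, ← Complex.exp_add]
    congr 1
    have : (lam n : ℂ) - lam m ≠ 0 := by exact_mod_cast hlne
    push_cast
    field_simp
    ring
  rw [h2] at h1
  have h3 : Complex.exp (-(I * (lam m : ℂ) * ((Real.pi / (lam n - lam m) : ℝ) : ℂ))) = 0 := by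
    linear_combination (-1 / 2 : ℂ) * h1
  exact Complex.exp_ne_zero _ h3

/-- The flow `t ↦ β(t)⁻¹`. -/
def inverseFlow (β : Multiplicative ℝ →ₜ* G) (t : ℝ) : G := (β (Multiplicative.ofAdd t))⁻¹

theorem continuous_inverseFlow (β : Multiplicative ℝ →ₜ* G) : Continuous (inverseFlow β) :=
  ((map_continuous β).comp continuous_ofAdd).inv

theorem inverseFlow_add (β : Multiplicative ℝ →ₜ* G) (s t : ℝ) :
    inverseFlow β (s + t) = inverseFlow β s * inverseFlow β t := by
  simp [inverseFlow, ofAdd_add, mul_comm]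

theorem IsDirichletGroup.char_inverseFlow (hG : IsDirichletGroup lam β) (n : ℕ) (t : ℝ) :
    ((hG.char n (inverseFlow β t) : Circle) : ℂ) = Complex.exp (I * lam n * t) := by
  rw [inverseFlow, map_inv, Circle.coe_inv, hG.char_spec n t, Complex.exp_neg, inv_inv]

/-- The kernel whose Fourier transform is `e^{-ux}` on `[0, a]` and vanishes on `[b, ∞)`. -/
noncomputable def cutoffKernel (a b u t : ℝ) : ℂ := poissonKernelReal u t + truncKernel a b u t

theorem integrable_cutoffKernel {a b u : ℝ} (hab : a < b) (hu : 0 < u) :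
    Integrable (cutoffKernel a b u) :=
  (integrable_poissonKernelReal hu).ofReal.add (integrable_truncKernel hab hu)

theorem integral_cutoffKernel_mul_exp {a b u x : ℝ} (hab : a < b) (hu : 0 < u) (hx : 0 ≤ x) :
    ∫ t : ℝ, cutoffKernel a b u t * Complex.exp (I * x * t) =
      (Real.exp (-(u * x)) * (1 - (max (x - a) 0 - max (x - b) 0) / (b - a)) : ℝ) := by
  have hb (K : ℝ → ℂ) (hK : Integrable K) : Integrable fun t : ℝ => K t * Complex.exp (I * x * t) := by
    refine hK.mul_bdd (c := 1) (Continuous.aestronglyMeasurable (by fun_prop))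
      (ae_of_all _ fun t => ?_)
    rw [Complex.norm_exp]
    simp
  simp only [cutoffKernel, add_mul]
  rw [integral_add (hb (fun t => (poissonKernelReal u t : ℂ)) (integrable_poissonKernelReal hu).ofReal)
    (hb _ (integrable_truncKernel hab hu)), integral_poissonKernelReal_mul_exp hu,
    integral_truncKernel_mul_exp hab hu, abs_of_nonneg hx]
  push_cast
  ring

theorem integrable_of_memHardy {hG : IsDirichletGroup lam β} {f : G → ℂ}
    (hf : MemHardy hG 1 μ f) : Integrable f μ :=
  memLp_one_iff_integrable.1 hf.memLp

/-- For fixed `u`, the partial sum is a convolution with the cutoff kernel along the flow. -/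
theorem partialFourierSum_ae_eq_integral (hlam : IsFrequency lam) (hG : IsDirichletGroup lam β)
    {f : G → ℂ} (hf : MemHardy hG 1 μ f) {u : ℝ} (hu : 0 < u) (N : ℕ) :
    ∀ᵐ ω ∂μ, partialFourierSum hG μ u f (N + 1) ω =
      ∫ t, cutoffKernel (lam N) (lam (N + 1)) u t * f (ω * inverseFlow β t) := by
  classical
  have hfi := integrable_of_memHardy hf
  have hab : lam N < lam (N + 1) := hlam.strictMono (Nat.lt_succ_self N)
  have hK := integrable_cutoffKernel hab hu
  have hγ := continuous_inverseFlow β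
  set P : G → ℂ := partialFourierSum hG μ u f (N + 1) with hP
  set F : G → ℂ := fun ω =>
    ∫ t, cutoffKernel (lam N) (lam (N + 1)) u t * f (ω * inverseFlow β t) with hF
  have hPi : Integrable P μ := by
    refine Continuous.integrable_of_hasCompactSupport ?_ (HasCompactSupport.of_compactSpace _)
    exact continuous_finsetSum _ fun n _ => continuous_const.mul (hG.char n).continuous_coe
  have hFi : Integrable F μ := (integrable_flow hγ hfi hK).integral_prod_right
  have hPc (ψ : PontryaginDual G) : groupFourierCoeff μ P ψ = ∑ n ∈ Finset.range (N + 1),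
      groupFourierCoeff μ f (hG.char n) * (Real.exp (-(u * lam n)) : ℂ) *
        if hG.char n = ψ then 1 else 0 :=
    groupFourierCoeff_sum _ _ _ ψ
  have hcoef (ψ : PontryaginDual G) : groupFourierCoeff μ P ψ = groupFourierCoeff μ F ψ := by
    rw [hF, groupFourierCoeff_flow hγ hfi hK, hPc]
    by_cases hψ : ψ ∈ Set.range hG.char
    · obtain ⟨m, rfl⟩ := hψ
      simp only [hG.char_inverseFlow, (hG.char_injective hlam).eq_iff, mul_ite, mul_one, mul_zero]
      rw [integral_cutoffKernel_mul_exp hab hu (hlam.nonneg m), Finset.sum_ite_eq']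
      have hd : lam (N + 1) - lam N ≠ 0 := (sub_pos.2 hab).ne'
      -- Every frequency is at most `λ_N`, where the multiplier is `e^{-ux}`, or at least `λ_{N+1}`,
      -- where it is `0`. The sloping part of the cutoff is never seen.
      by_cases hm : m ≤ N
      · have h1 : lam m ≤ lam N := hlam.strictMono.monotone hm
        rw [if_pos (Finset.mem_range.2 (Nat.lt_succ_of_le hm)), max_eq_right (by linarith),
          max_eq_right (by linarith)]
        simp [mul_comm]
      · have h1 : lam (N + 1) ≤ lam m := hlam.strictMono.monotone (by omega)
        rw [if_neg (by simpa using hm), max_eq_left (by linarith), max_eq_left (by linarith)]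
        have h2 : (lam m - lam N - (lam m - lam (N + 1))) / (lam (N + 1) - lam N) = 1 := by
          rw [div_eq_one_iff_eq hd]; ring
        rw [h2]
        simp
    · rw [hf.fourier_support ψ hψ, mul_zero]
      refine Finset.sum_eq_zero fun n _ => ?_
      rw [if_neg fun e => hψ ⟨n, e⟩, mul_zero]
  have hsub : ∀ ψ, groupFourierCoeff μ (P - F) ψ = 0 := by
    intro ψ
    have hb (g : G → ℂ) (hg : Integrable g μ) :
        Integrable (fun ω => g ω * (starRingEnd ℂ) ((ψ ω : Circle) : ℂ)) μ := by
      refine hg.mul_bdd (c := 1)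
        (Complex.continuous_conj.comp ψ.continuous_coe).aestronglyMeasurable
        (ae_of_all _ fun ω => ?_)
      rw [RCLike.norm_conj, Circle.norm_coe]
    have := hcoef ψ
    rw [← sub_eq_zero] at this
    rw [← this]
    simp only [groupFourierCoeff, Pi.sub_apply, sub_mul]
    exact integral_sub (hb P hPi) (hb F hFi)
  filter_upwards [ae_eq_zero_of_groupFourierCoeff_eq_zero μ (hPi.sub hFi) hsub] with ω hω
  exact sub_eq_zero.1 hω

theorem norm_poissonKernelReal_le {u v t : ℝ} (hu : 0 < u) (h1 : u / 2 < v) (h2 : v < 2 * u) :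
    ‖(poissonKernelReal v t : ℂ)‖ ≤ 2 * u * ((u / 2) ^ 2 + t ^ 2)⁻¹ := by
  have hv : 0 < v := by linarith
  rw [Complex.norm_real, poissonKernelReal, Real.norm_of_nonneg (by positivity)]
  calc 1 / Real.pi * (v / (v ^ 2 + t ^ 2)) ≤ 1 * (2 * u / ((u / 2) ^ 2 + t ^ 2)) := by
        gcongr
        rw [div_le_one Real.pi_pos]
        linarith [Real.pi_gt_three]
    _ = _ := by rw [one_mul, div_eq_mul_inv]

/-- Comparison with the fixed weight `(1 + t²)⁻¹` lets one integrability condition on an orbit serve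
all `u > 0` at once. -/
theorem inv_sq_add_sq_le {u : ℝ} (hu : 0 < u) (t : ℝ) :
    (u ^ 2 + t ^ 2)⁻¹ ≤ (1 + (u ^ 2)⁻¹) * (1 + t ^ 2)⁻¹ := by
  rw [inv_eq_one_div, ← div_eq_mul_inv, div_le_div_iff₀ (by positivity) (by positivity)]
  have h1 : (u ^ 2)⁻¹ * u ^ 2 = 1 := inv_mul_cancel₀ (by positivity)
  have h2 : 0 ≤ (u ^ 2)⁻¹ * t ^ 2 := by positivity
  nlinarith [sq_nonneg u, sq_nonneg t]

/-- The bound is uniform for `v` between `u / 2` and `2u`. It is the majorant for dominated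
convergence in the parameter. -/
theorem norm_cutoffKernel_le {a b u v : ℝ} (ha : 0 ≤ a) (hab : a < b) (hu : 0 < u)
    (h1 : u / 2 < v) (h2 : v < 2 * u) (t : ℝ) :
    ‖cutoffKernel a b v t‖ ≤
      (2 * u + (b - a)⁻¹) * (1 + ((u / 2) ^ 2)⁻¹) * (1 + t ^ 2)⁻¹ := by
  have hv : 0 < v := by linarith
  have hd : 0 < b - a := sub_pos.2 hab
  have h3 : ‖truncKernel a b v t‖ ≤ (b - a)⁻¹ * ((u / 2) ^ 2 + t ^ 2)⁻¹ := by
    refine (norm_truncKernel_le_quadratic hab hv t).trans ?_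
    calc _ ≤ 1 * ((b - a)⁻¹ * ((u / 2) ^ 2 + t ^ 2)⁻¹) := by
          gcongr
          exact Real.exp_le_one_iff.2 (by have := mul_nonneg hv.le ha; linarith)
      _ = _ := one_mul _
  calc ‖cutoffKernel a b v t‖
      ≤ 2 * u * ((u / 2) ^ 2 + t ^ 2)⁻¹ + (b - a)⁻¹ * ((u / 2) ^ 2 + t ^ 2)⁻¹ :=
        (norm_add_le _ _).trans (add_le_add (norm_poissonKernelReal_le hu h1 h2) h3)
    _ = (2 * u + (b - a)⁻¹) * ((u / 2) ^ 2 + t ^ 2)⁻¹ := by ring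
    _ ≤ (2 * u + (b - a)⁻¹) * ((1 + ((u / 2) ^ 2)⁻¹) * (1 + t ^ 2)⁻¹) := by
        gcongr
        exact inv_sq_add_sq_le (half_pos hu) t
    _ = _ := by ring

theorem continuousAt_cutoffKernel {a b u : ℝ} (hu : 0 < u) (t : ℝ) :
    ContinuousAt (fun v => cutoffKernel a b v t) u := by
  unfold cutoffKernel truncKernel poissonKernelReal
  have h1 : u ^ 2 + t ^ 2 ≠ 0 := by positivity
  have h2 : ((u : ℂ) + I * t) ^ 2 ≠ 0 := pow_ne_zero _ (add_I_mul_ne_zero hu t)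
  refine ContinuousAt.add ?_ ?_
  · exact Complex.continuous_ofReal.continuousAt.comp
      (continuousAt_const.mul (continuousAt_id.div (by fun_prop) h1))
  · refine continuousAt_const.mul (ContinuousAt.mul (by fun_prop) (ContinuousAt.inv₀ ?_ h2))
    fun_prop

theorem continuousOn_integral_cutoffKernel {a b : ℝ} (ha : 0 ≤ a) (hab : a < b) {φ : ℝ → ℂ}
    (hφ : Integrable fun t : ℝ => ((1 + t ^ 2)⁻¹ : ℝ) * φ t) (hφm : AEStronglyMeasurable φ volume) :
    ContinuousOn (fun u => ∫ t, cutoffKernel a b u t * φ t) (Set.Ioi 0) := by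
  intro u hu
  have hu : 0 < u := hu
  refine ContinuousAt.continuousWithinAt ?_
  refine continuousAt_of_dominated (bound := fun t => (2 * u + (b - a)⁻¹) *
    (1 + ((u / 2) ^ 2)⁻¹) * ‖((1 + t ^ 2)⁻¹ : ℝ) * φ t‖) ?_ ?_ (hφ.norm.const_mul _) ?_
  · filter_upwards [lt_mem_nhds hu] with v hv
    exact (integrable_cutoffKernel hab hv).aestronglyMeasurable.mul hφm
  · filter_upwards [lt_mem_nhds (show u / 2 < u by linarith),
      gt_mem_nhds (show u < 2 * u by linarith)] with v h1 h2
    refine ae_of_all _ fun t => ?_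
    rw [norm_mul, norm_mul, Complex.norm_real, Real.norm_of_nonneg (by positivity), ← mul_assoc]
    gcongr
    exact norm_cutoffKernel_le ha hab hu h1 h2 t
  · exact ae_of_all _ fun t => (continuousAt_cutoffKernel hu t).mul continuousAt_const

theorem ae_integrable_inv_one_add_sq_mul (β : Multiplicative ℝ →ₜ* G) {f : G → ℂ}
    (hf : Integrable f μ) : ∀ᵐ ω ∂μ,
      Integrable fun t : ℝ => (((1 + t ^ 2)⁻¹ : ℝ) : ℂ) * f (ω * inverseFlow β t) :=
  ae_integrable_flow (continuous_inverseFlow β) hf integrable_inv_one_add_sq.ofReal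

theorem aestronglyMeasurable_of_inv_one_add_sq_mul {φ : ℝ → ℂ}
    (hφ : Integrable fun t : ℝ => ((1 + t ^ 2)⁻¹ : ℝ) * φ t) : AEStronglyMeasurable φ volume := by
  have h1 : AEStronglyMeasurable (fun t : ℝ => ((1 + t ^ 2 : ℝ) : ℂ)) volume :=
    Continuous.aestronglyMeasurable (by fun_prop)
  refine (h1.mul hφ.aestronglyMeasurable).congr (ae_of_all _ fun t => ?_)
  have h2 : ((1 + t ^ 2 : ℝ) : ℂ) ≠ 0 := by
    have : (1 + t ^ 2 : ℝ) ≠ 0 := by positivity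
    exact_mod_cast this
  simp only [Pi.mul_apply]
  rw [Complex.ofReal_inv, mul_inv_cancel_left₀ h2]

/-- Outside one null set, all partial sums are convolutions with cutoff kernels, for all `u`. -/
theorem ae_forall_partialFourierSum_eq_integral (hlam : IsFrequency lam)
    (hG : IsDirichletGroup lam β) {f : G → ℂ} (hf : MemHardy hG 1 μ f) :
    ∀ᵐ ω ∂μ, ∀ N : ℕ, ∀ u : ℝ, 0 < u → partialFourierSum hG μ u f (N + 1) ω =
      ∫ t, cutoffKernel (lam N) (lam (N + 1)) u t * f (ω * inverseFlow β t) := by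
  have h1 : ∀ᵐ ω ∂μ, ∀ N : ℕ, ∀ q : ℚ, 0 < (q : ℝ) →
      partialFourierSum hG μ q f (N + 1) ω =
        ∫ t, cutoffKernel (lam N) (lam (N + 1)) q t * f (ω * inverseFlow β t) :=
    ae_all_iff.2 fun N => ae_all_iff.2 fun q => by
      by_cases hq : 0 < (q : ℝ)
      · filter_upwards [partialFourierSum_ae_eq_integral hlam hG hf hq N] with ω hω _ using hω
      · exact ae_of_all _ fun ω h => absurd h hq
  filter_upwards [h1, ae_integrable_inv_one_add_sq_mul β (integrable_of_memHardy hf)]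
    with ω hω hint N u hu
  have hm := aestronglyMeasurable_of_inv_one_add_sq_mul hint
  have hab : lam N < lam (N + 1) := hlam.strictMono (Nat.lt_succ_self N)
  -- The exceptional set has been chosen for countably many rational `u`. Both sides are continuous
  -- in `u > 0`, so equality extends to all real `u > 0`.
  refine Set.EqOn.of_subset_closure (s := Set.Ioi 0 ∩ Set.range ((↑) : ℚ → ℝ)) (t := Set.Ioi 0)
    (f := fun u => partialFourierSum hG μ u f (N + 1) ω)
    (g := fun u => ∫ t, cutoffKernel (lam N) (lam (N + 1)) u t * f (ω * inverseFlow β t))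
    ?_ ?_ (continuousOn_integral_cutoffKernel (hlam.nonneg N) hab hint hm) Set.inter_subset_left
    (Dense.open_subset_closure_inter Rat.denseRange_cast isOpen_Ioi) hu
  · rintro _ ⟨hq, q, rfl⟩
    exact hω N q hq
  · unfold partialFourierSum
    fun_prop

end Identity

/-! ### Poisson convolution and comparison with partial sums -/

section Convolution

variable {G : Type*} [CommGroup G] [TopologicalSpace G] [IsTopologicalGroup G]
  [CompactSpace G] [T2Space G] [MeasurableSpace G] [BorelSpace G]
  {μ : Measure G} [μ.IsHaarMeasure] [μ.Regular] [IsProbabilityMeasure μ]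
  {lam : ℕ → ℝ} {β : Multiplicative ℝ →ₜ* G}

theorem continuous_poissonKernelReal {u : ℝ} (hu : 0 < u) : Continuous (poissonKernelReal u) :=
  continuous_const.mul (continuous_const.div (by fun_prop) fun t => by positivity)

theorem integrable_mul_of_norm_le_inv {φ K : ℝ → ℂ} {C : ℝ}
    (hφ : Integrable fun t : ℝ => ((1 + t ^ 2)⁻¹ : ℝ) * φ t) (hK : AEStronglyMeasurable K volume)
    (hb : ∀ t, ‖K t‖ ≤ C * (1 + t ^ 2)⁻¹) : Integrable fun t => K t * φ t := by
  refine (hφ.norm.const_mul C).mono' (hK.mul (aestronglyMeasurable_of_inv_one_add_sq_mul hφ))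
    (ae_of_all _ fun t => ?_)
  rw [norm_mul, norm_mul, Complex.norm_real, Real.norm_of_nonneg (by positivity), ← mul_assoc]
  gcongr
  exact hb t

theorem integrable_poissonKernelReal_mul {φ : ℝ → ℂ}
    (hφ : Integrable fun t : ℝ => ((1 + t ^ 2)⁻¹ : ℝ) * φ t) {u : ℝ} (hu : 0 < u) :
    Integrable fun t => (poissonKernelReal u t : ℂ) * φ t := by
  refine integrable_mul_of_norm_le_inv (C := 2 * u * (1 + ((u / 2) ^ 2)⁻¹)) hφ
    (integrable_poissonKernelReal hu).ofReal.aestronglyMeasurable fun t => ?_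
  refine (norm_poissonKernelReal_le hu (by linarith) (by linarith)).trans ?_
  rw [mul_assoc (2 * u)]
  exact mul_le_mul_of_nonneg_left (inv_sq_add_sq_le (half_pos hu) t) (by positivity)

theorem integrable_cutoffKernel_mul {φ : ℝ → ℂ}
    (hφ : Integrable fun t : ℝ => ((1 + t ^ 2)⁻¹ : ℝ) * φ t) {a b u : ℝ} (ha : 0 ≤ a) (hab : a < b)
    (hu : 0 < u) : Integrable fun t => cutoffKernel a b u t * φ t :=
  integrable_mul_of_norm_le_inv hφ (integrable_cutoffKernel hab hu).aestronglyMeasurable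
    (norm_cutoffKernel_le ha hab hu (by linarith) (by linarith))

/-- Almost every orbit turns the convolution with Poisson measures on the group into integrals
against Poisson kernels on the line. -/
theorem ae_convMeasure_poissonMeasureOn (β : Multiplicative ℝ →ₜ* G) {f : G → ℂ}
    (hf : Integrable f μ) : ∀ᵐ ω ∂μ, ∀ u : ℝ, 0 < u →
      Integrable (fun η => f (ω * η⁻¹)) (poissonMeasureOn β u) ∧
      convMeasure f (poissonMeasureOn β u) ω =
        ∫ t, (poissonKernelReal u t : ℂ) * f (ω * inverseFlow β t) := by
  obtain ⟨g, hg, hfg⟩ := hf.aestronglyMeasurable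
  -- The set where `f` differs from its measurable version need not be measurable. Its null
  -- measurable hull can be pulled back through the image measure `p_u`.
  have hnull : ∀ᵐ x ∂μ, x ∉ toMeasurable μ {x | ¬ f x = g x} := by
    rw [ae_iff]
    simp only [not_not, Set.ofPred_mem_eq, measure_toMeasurable]
    exact hfg
  filter_upwards [ae_ae_flow (continuous_inverseFlow β) hnull,
    ae_integrable_inv_one_add_sq_mul β hf] with ω hω hint u hu
  have hβ : Measurable fun t : ℝ => β (Multiplicative.ofAdd t) :=
    ((map_continuous β).comp continuous_ofAdd).measurable
  have hmeas : Measurable fun η : G => ω * η⁻¹ := (by fun_prop : Continuous _).measurable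
  have hρ : Measurable fun t : ℝ => ENNReal.ofReal (poissonKernelReal u t) :=
    (continuous_poissonKernelReal hu).measurable.ennreal_ofReal
  have hρtop : ∀ᵐ t : ℝ, ENNReal.ofReal (poissonKernelReal u t) < ∞ :=
    ae_of_all _ fun t => ENNReal.ofReal_lt_top
  have hae : (fun η => f (ω * η⁻¹)) =ᵐ[poissonMeasureOn β u] fun η => g (ω * η⁻¹) := by
    have h1 : ∀ᵐ η ∂poissonMeasureOn β u, ω * η⁻¹ ∉ toMeasurable μ {x | ¬ f x = g x} := by
      rw [poissonMeasureOn]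
      exact (ae_map_iff hβ.aemeasurable (hmeas (measurableSet_toMeasurable _ _)).compl).2
        ((withDensity_absolutelyContinuous _ _).ae_le hω)
    filter_upwards [h1] with η hη
    by_contra hne
    exact hη (subset_toMeasurable _ _ hne)
  have hsm : AEStronglyMeasurable (fun η => f (ω * η⁻¹)) (poissonMeasureOn β u) :=
    ⟨_, hg.comp_measurable hmeas, hae⟩
  have hpos (t : ℝ) : 0 ≤ poissonKernelReal u t := by
    unfold poissonKernelReal
    positivity
  constructor
  · rw [poissonMeasureOn, integrable_map_measure hsm hβ.aemeasurable,
      integrable_withDensity_iff_integrable_smul' hρ hρtop]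
    refine (integrable_poissonKernelReal_mul hint hu).congr (ae_of_all _ fun t => ?_)
    simp only [Function.comp, ENNReal.toReal_ofReal (hpos t), Complex.real_smul]
    rfl
  · rw [convMeasure, poissonMeasureOn, integral_map hβ.aemeasurable hsm,
      integral_withDensity_eq_integral_toReal_smul hρ hρtop]
    congr 1 with t : 1
    rw [ENNReal.toReal_ofReal (hpos t), Complex.real_smul]
    rfl

/-- The two-sided maximal function along `β`. -/
noncomputable def twoSidedMax (β : Multiplicative ℝ →ₜ* G) (f : G → ℂ) (ω : G) : ℝ≥0∞ :=
  flowMax (inverseFlow β) (fun x => ‖f x‖ₑ) ω +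
    flowMax (fun t => inverseFlow β (-t)) (fun x => ‖f x‖ₑ) ω

theorem enorm_integral_mul_le (K φ : ℝ → ℂ) :
    ‖∫ t, K t * φ t‖ₑ ≤ ∫⁻ t, ‖φ t‖ₑ * ‖K t‖ₑ := by
  refine (enorm_integral_le_lintegral_enorm _).trans (lintegral_mono fun t => ?_)
  rw [enorm_mul, mul_comm]

theorem enorm_integral_poissonKernelReal_le {u : ℝ} (hu : 0 < u) :
    ∃ B : ℝ≥0, ∀ (f : G → ℂ) (ω : G),
      ‖∫ t, (poissonKernelReal u t : ℂ) * f (ω * inverseFlow β t)‖ₑ ≤ B * twoSidedMax β f ω := by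
  obtain ⟨B, hB⟩ := lintegral_mul_poissonKernelReal_le hu
  refine ⟨B, fun f ω => (enorm_integral_mul_le _ _).trans ?_⟩
  have h := hB (fun t => ‖f (ω * inverseFlow β t)‖ₑ) _ _
    (sum_le_mul_flowMax (inverseFlow β) (fun x => ‖f x‖ₑ) ω)
    (sum_le_mul_flowMax (fun t => inverseFlow β (-t)) (fun x => ‖f x‖ₑ) ω)
  refine le_trans (le_of_eq (lintegral_congr fun t => ?_)) h
  congr 1
  rw [← ofReal_norm, ← ofReal_norm, Complex.norm_real]

/-- The distance of the partial sums to the Poisson integral. -/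
theorem enorm_partialFourierSum_sub_le (hlam : IsFrequency lam) (hLC : LandauCondition lam)
    (hG : IsDirichletGroup lam β) {u : ℝ} (hu : 0 < u) :
    ∃ B : ℝ, 0 ≤ B ∧ ∀ (f : G → ℂ) (ω : G),
      (Integrable fun t : ℝ => (((1 + t ^ 2)⁻¹ : ℝ) : ℂ) * f (ω * inverseFlow β t)) →
      (∀ N : ℕ, partialFourierSum hG μ u f (N + 1) ω =
        ∫ t, cutoffKernel (lam N) (lam (N + 1)) u t * f (ω * inverseFlow β t)) →
      ∀ N : ℕ, ‖partialFourierSum hG μ u f (N + 1) ω -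
        ∫ t, (poissonKernelReal u t : ℂ) * f (ω * inverseFlow β t)‖ₑ ≤
          ENNReal.ofReal (B * Real.exp (-(u / 2 * lam N))) * twoSidedMax β f ω := by
  obtain ⟨B, hB0, hB⟩ := hLC.exists_exp_mul_log_le hlam hu
  refine ⟨B, hB0, fun f ω hint hid N => ?_⟩
  have hab : lam N < lam (N + 1) := hlam.strictMono (Nat.lt_succ_self N)
  rw [hid N, ← integral_sub (integrable_cutoffKernel_mul hint (hlam.nonneg N) hab hu)
    (integrable_poissonKernelReal_mul hint hu)]
  have h1 (t : ℝ) : cutoffKernel (lam N) (lam (N + 1)) u t * f (ω * inverseFlow β t) -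
      (poissonKernelReal u t : ℂ) * f (ω * inverseFlow β t) =
      truncKernel (lam N) (lam (N + 1)) u t * f (ω * inverseFlow β t) := by
    rw [cutoffKernel]
    ring
  simp only [h1]
  refine (enorm_integral_mul_le _ _).trans ?_
  refine (lintegral_mul_truncKernel_le hab hu _ _ _
    (sum_le_mul_flowMax (inverseFlow β) (fun x => ‖f x‖ₑ) ω)
    (sum_le_mul_flowMax (fun t => inverseFlow β (-t)) (fun x => ‖f x‖ₑ) ω)).trans ?_
  exact mul_le_mul_left (ENNReal.ofReal_le_ofReal (hB N)) _

theorem continuous_inverseFlow_neg (β : Multiplicative ℝ →ₜ* G) :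
    Continuous fun t => inverseFlow β (-t) :=
  (continuous_inverseFlow β).comp continuous_neg

theorem inverseFlow_neg_add (β : Multiplicative ℝ →ₜ* G) (s t : ℝ) :
    inverseFlow β (-(s + t)) = inverseFlow β (-s) * inverseFlow β (-t) := by
  rw [neg_add, inverseFlow_add]

theorem lintegral_enorm_ne_top {f : G → ℂ} (hf : Integrable f μ) : ∫⁻ x, ‖f x‖ₑ ∂μ ≠ ∞ := hf.2.ne

theorem ae_twoSidedMax_lt_top (β : Multiplicative ℝ →ₜ* G) {f : G → ℂ} (hf : Integrable f μ) :
    ∀ᵐ ω ∂μ, twoSidedMax β f ω < ∞ := by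
  filter_upwards [ae_flowMax_lt_top (continuous_inverseFlow β) (inverseFlow_add β)
      hf.aestronglyMeasurable.enorm (lintegral_enorm_ne_top hf),
    ae_flowMax_lt_top (continuous_inverseFlow_neg β) (inverseFlow_neg_add β)
      hf.aestronglyMeasurable.enorm (lintegral_enorm_ne_top hf)] with ω h1 h2
  exact ENNReal.add_lt_top.2 ⟨h1, h2⟩

/-- If the sum exceeds `α / B`, one of the two one-sided maximal functions exceeds `α / (2B)`. Each
contributes `2B / α` times the norm. -/
theorem measure_lt_mul_twoSidedMax_le (β : Multiplicative ℝ →ₜ* G) {f : G → ℂ}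
    (hf : Integrable f μ) {B : ℝ≥0} (hB : 0 < B) {α : ℝ≥0} (hα : 0 < α) :
    μ {ω | (α : ℝ≥0∞) < B * twoSidedMax β f ω} ≤
      (4 * B : ℝ≥0) * (∫⁻ x, ‖f x‖ₑ ∂μ) / α := by
  set α' : ℝ≥0 := α / (2 * B) with hα'
  have hα'0 : 0 < α' := by positivity
  have h1 := measure_lt_flowMax_le (continuous_inverseFlow β) (inverseFlow_add β)
      hf.aestronglyMeasurable.enorm (lintegral_enorm_ne_top hf) hα'0
  have h2 := measure_lt_flowMax_le (continuous_inverseFlow_neg β) (inverseFlow_neg_add β)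
      hf.aestronglyMeasurable.enorm (lintegral_enorm_ne_top hf) hα'0
  have hsub : {ω | (α : ℝ≥0∞) < B * twoSidedMax β f ω} ⊆
      {ω | (α' : ℝ≥0∞) < flowMax (inverseFlow β) (fun x => ‖f x‖ₑ) ω} ∪
      {ω | (α' : ℝ≥0∞) < flowMax (fun t => inverseFlow β (-t)) (fun x => ‖f x‖ₑ) ω} := by
    intro ω hω
    by_contra hcon
    simp only [Set.mem_union, Set.mem_ofPred_eq, not_or, not_lt] at hcon
    refine (not_le.2 (show (α : ℝ≥0∞) < B * twoSidedMax β f ω from hω)) ?_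
    calc (B : ℝ≥0∞) * twoSidedMax β f ω ≤ B * (α' + α') := by
          unfold twoSidedMax
          gcongr
          exacts [hcon.1, hcon.2]
      _ = α := by
          have : B * (α' + α') = α := by
            rw [hα']
            field_simp
            norm_num
          exact_mod_cast this
  refine (measure_mono hsub).trans ((measure_union_le _ _).trans ((add_le_add h1 h2).trans ?_))
  have h3 : (α' : ℝ≥0∞)⁻¹ = (2 * B : ℝ≥0) * (α : ℝ≥0∞)⁻¹ := by
    rw [← ENNReal.coe_inv hα'0.ne', ← ENNReal.coe_inv hα.ne', ← ENNReal.coe_mul, hα', inv_div,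
      div_eq_mul_inv]
  rw [ENNReal.div_eq_inv_mul, ENNReal.div_eq_inv_mul, h3]
  refine le_of_eq ?_
  push_cast
  ring

end Convolution

/-! ### The maximal operator and pointwise convergence -/

section MaximalOperator

variable {G : Type*} [CommGroup G] [TopologicalSpace G] [IsTopologicalGroup G]
  [CompactSpace G] [T2Space G] [MeasurableSpace G] [BorelSpace G]
  {μ : Measure G} [μ.IsHaarMeasure] [μ.Regular] [IsProbabilityMeasure μ]
  {lam : ℕ → ℝ} {β : Multiplicative ℝ →ₜ* G}

theorem integrable_mul_conj_char {f : G → ℂ} (hf : Integrable f μ) (χ : PontryaginDual G) :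
    Integrable (fun ω => f ω * (starRingEnd ℂ) ((χ ω : Circle) : ℂ)) μ := by
  refine hf.mul_bdd (c := 1) (Complex.continuous_conj.comp χ.continuous_coe).aestronglyMeasurable
    (ae_of_all _ fun ω => ?_)
  rw [RCLike.norm_conj, Circle.norm_coe]

theorem partialFourierSum_add (hG : IsDirichletGroup lam β) (u : ℝ) {f g : G → ℂ}
    (hf : Integrable f μ) (hg : Integrable g μ) (N : ℕ) (ω : G) :
    partialFourierSum hG μ u (f + g) N ω =
      partialFourierSum hG μ u f N ω + partialFourierSum hG μ u g N ω := by
  have h (χ : PontryaginDual G) : groupFourierCoeff μ (f + g) χ =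
      groupFourierCoeff μ f χ + groupFourierCoeff μ g χ := by
    simp only [groupFourierCoeff, Pi.add_apply, add_mul]
    exact integral_add (integrable_mul_conj_char hf χ) (integrable_mul_conj_char hg χ)
  simp only [partialFourierSum, h, add_mul, Finset.sum_add_distrib]

theorem partialFourierSum_smul (hG : IsDirichletGroup lam β) (u : ℝ) (c : ℂ) (f : G → ℂ)
    (N : ℕ) (ω : G) :
    partialFourierSum hG μ u (c • f) N ω = c * partialFourierSum hG μ u f N ω := by
  have h (χ : PontryaginDual G) : groupFourierCoeff μ (c • f) χ = c * groupFourierCoeff μ f χ := by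
    simp only [groupFourierCoeff, Pi.smul_apply, smul_eq_mul, mul_assoc]
    exact integral_const_mul _ _
  simp only [partialFourierSum, h, Finset.mul_sum, mul_assoc]

theorem maximalOperator_add_le (hG : IsDirichletGroup lam β) (u : ℝ) {f g : G → ℂ}
    (hf : Integrable f μ) (hg : Integrable g μ) (ω : G) :
    maximalOperator hG μ u (f + g) ω ≤
      maximalOperator hG μ u f ω + maximalOperator hG μ u g ω := by
  refine iSup_le fun N => ?_
  rw [partialFourierSum_add hG u hf hg]
  exact (enorm_add_le _ _).trans (add_le_add
    (le_iSup (fun N => ‖partialFourierSum hG μ u f (N + 1) ω‖ₑ) N)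
    (le_iSup (fun N => ‖partialFourierSum hG μ u g (N + 1) ω‖ₑ) N))

theorem maximalOperator_smul (hG : IsDirichletGroup lam β) (u : ℝ) (c : ℂ) (f : G → ℂ) (ω : G) :
    maximalOperator hG μ u (c • f) ω = ‖c‖ₑ * maximalOperator hG μ u f ω := by
  simp only [maximalOperator, partialFourierSum_smul, enorm_mul, ENNReal.mul_iSup]

theorem measurable_maximalOperator (hG : IsDirichletGroup lam β) (u : ℝ) (f : G → ℂ) :
    Measurable (maximalOperator hG μ u f) :=
  Measurable.iSup fun _ => (continuous_finsetSum _ fun n _ =>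
    continuous_const.mul (hG.char n).continuous_coe).measurable.enorm

/-- Each partial sum is the Poisson integral plus the truncation error, and both are dominated by
the maximal function uniformly in `N`. The added `1` only makes the constant positive. -/
theorem exists_maximalOperator_le_twoSidedMax (hlam : IsFrequency lam) (hLC : LandauCondition lam)
    (hG : IsDirichletGroup lam β) {u : ℝ} (hu : 0 < u) :
    ∃ B : ℝ≥0, 0 < B ∧ ∀ f : G → ℂ, MemHardy hG 1 μ f →
      ∀ᵐ ω ∂μ, maximalOperator hG μ u f ω ≤ B * twoSidedMax β f ω := by
  obtain ⟨B, hB0, hB⟩ := enorm_partialFourierSum_sub_le (μ := μ) hlam hLC hG hu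
  obtain ⟨D, hD⟩ := enorm_integral_poissonKernelReal_le (G := G) (β := β) hu
  refine ⟨B.toNNReal + D + 1, by positivity, fun f hf => ?_⟩
  filter_upwards [ae_forall_partialFourierSum_eq_integral hlam hG hf,
    ae_integrable_inv_one_add_sq_mul β (integrable_of_memHardy hf)] with ω hid hint
  refine iSup_le fun N => ?_
  have h1 := hB f ω hint (fun N => hid N u hu) N
  have h2 : ENNReal.ofReal (B * Real.exp (-(u / 2 * lam N))) ≤ B.toNNReal := by
    refine ENNReal.ofReal_le_ofReal (mul_le_of_le_one_right hB0 (Real.exp_le_one_iff.2 ?_))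
    have := mul_nonneg (half_pos hu).le (hlam.nonneg N)
    linarith
  calc ‖partialFourierSum hG μ u f (N + 1) ω‖ₑ
      ≤ ‖partialFourierSum hG μ u f (N + 1) ω -
          ∫ t, (poissonKernelReal u t : ℂ) * f (ω * inverseFlow β t)‖ₑ +
          ‖∫ t, (poissonKernelReal u t : ℂ) * f (ω * inverseFlow β t)‖ₑ := by
        refine le_trans (le_of_eq ?_) (enorm_add_le _ _)
        rw [sub_add_cancel]
    _ ≤ B.toNNReal * twoSidedMax β f ω + D * twoSidedMax β f ω :=
        add_le_add (h1.trans (mul_le_mul_left h2 _)) (hD f ω)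
    _ ≤ _ := by
        rw [← add_mul]
        gcongr
        push_cast
        exact le_self_add

theorem tendsto_partialFourierSum (hlam : IsFrequency lam) (hLC : LandauCondition lam)
    (hG : IsDirichletGroup lam β) {f : G → ℂ} {u : ℝ} (hu : 0 < u) {ω : G}
    (hint : Integrable fun t : ℝ => (((1 + t ^ 2)⁻¹ : ℝ) : ℂ) * f (ω * inverseFlow β t))
    (hid : ∀ N : ℕ, partialFourierSum hG μ u f (N + 1) ω =
        ∫ t, cutoffKernel (lam N) (lam (N + 1)) u t * f (ω * inverseFlow β t))
    (hmax : twoSidedMax β f ω < ∞) :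
    Tendsto (fun N : ℕ => partialFourierSum hG μ u f N ω) atTop
      (𝓝 (∫ t, (poissonKernelReal u t : ℂ) * f (ω * inverseFlow β t))) := by
  obtain ⟨B, hB0, hB⟩ := enorm_partialFourierSum_sub_le (μ := μ) hlam hLC hG hu
  rw [← tendsto_add_atTop_iff_nat 1, tendsto_iff_edist_tendsto_0]
  have h1 : Tendsto (fun N => B * Real.exp (-(u / 2 * lam N))) atTop (𝓝 (B * 0)) :=
    (Real.tendsto_exp_neg_atTop_nhds_zero.comp
      (hlam.tendsto_atTop.const_mul_atTop (half_pos hu))).const_mul B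
  have h2 : Tendsto (fun N => ENNReal.ofReal (B * Real.exp (-(u / 2 * lam N))) *
      twoSidedMax β f ω) atTop (𝓝 0) := by
    have := ENNReal.Tendsto.mul_const (ENNReal.tendsto_ofReal h1) (Or.inr hmax.ne)
    simpa using this
  refine tendsto_of_tendsto_of_tendsto_of_le_of_le tendsto_const_nhds h2 (fun _ => zero_le)
    fun N => ?_
  rw [edist_eq_enorm_sub]
  exact hB f ω hint hid N

end MaximalOperator

theorem mainTheorem3 {G : Type*} [CommGroup G] [TopologicalSpace G] [IsTopologicalGroup G]
    [CompactSpace G] [T2Space G] [MeasurableSpace G] [BorelSpace G]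
    (μ : Measure G) [μ.IsHaarMeasure] [μ.Regular] [IsProbabilityMeasure μ]
    (lam : ℕ → ℝ) (hlam : IsFrequency lam) (hLC : LandauCondition lam)
    (β : Multiplicative ℝ →ₜ* G) (hG : IsDirichletGroup lam β) :
    (∀ u : ℝ, 0 < u →
      (∀ f g : G → ℂ, MemHardy hG 1 μ f → MemHardy hG 1 μ g → ∀ ω,
        maximalOperator hG μ u (f + g) ω ≤ maximalOperator hG μ u f ω + maximalOperator hG μ u g ω) ∧
      (∀ (c : ℂ) (f : G → ℂ), MemHardy hG 1 μ f → ∀ ω,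
        maximalOperator hG μ u (c • f) ω = ‖c‖ₑ * maximalOperator hG μ u f ω) ∧
      ∃ C : ℝ≥0, ∀ f : G → ℂ, MemHardy hG 1 μ f →
        MemWeakL1 μ (maximalOperator hG μ u f) ∧
        weakL1Norm μ (maximalOperator hG μ u f) ≤ C * eLpNorm f 1 μ) ∧
    (∀ f : G → ℂ, MemHardy hG 1 μ f →
      ∀ᵐ ω ∂μ, ∀ u : ℝ, 0 < u →
        Integrable (fun η => f (ω * η⁻¹)) (poissonMeasureOn β u) ∧
        Tendsto (fun N : ℕ => partialFourierSum hG μ u f N ω) atTop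
          (𝓝 (convMeasure f (poissonMeasureOn β u) ω))) := by
  refine ⟨fun u hu => ⟨fun f g hf hg ω => maximalOperator_add_le hG u (integrable_of_memHardy hf)
    (integrable_of_memHardy hg) ω, fun c f _ ω => maximalOperator_smul hG u c f ω, ?_⟩, ?_⟩
  · obtain ⟨B, hB0, hB⟩ := exists_maximalOperator_le_twoSidedMax (μ := μ) hlam hLC hG hu
    refine ⟨4 * B, fun f hf => ?_⟩
    have hfi := integrable_of_memHardy hf
    have hnorm : weakL1Norm μ (maximalOperator hG μ u f) ≤ (4 * B : ℝ≥0) * eLpNorm f 1 μ := by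
      refine sInf_le fun α hα => ?_
      rw [eLpNorm_one_eq_lintegral_enorm]
      refine le_trans (measure_mono_ae ?_) (measure_lt_mul_twoSidedMax_le β hfi hB0 hα)
      filter_upwards [hB f hf] with ω hω (h1 : (α : ℝ≥0∞) < maximalOperator hG μ u f ω)
      exact h1.trans_le hω
    refine ⟨⟨measurable_maximalOperator hG u f, ?_, ?_⟩, hnorm⟩
    · filter_upwards [hB f hf, ae_twoSidedMax_lt_top β hfi] with ω h1 h2
      exact h1.trans_lt (ENNReal.mul_lt_top ENNReal.coe_lt_top h2)
    · exact hnorm.trans_lt (ENNReal.mul_lt_top ENNReal.coe_lt_top hf.memLp.eLpNorm_lt_top)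
  · intro f hf
    have hfi := integrable_of_memHardy hf
    -- The maximal function does not involve `u`, and the other three conditions already hold for
    -- all `u > 0` or do not involve it. One null set therefore serves every `u`.
    filter_upwards [ae_convMeasure_poissonMeasureOn β hfi, ae_twoSidedMax_lt_top β hfi,
      ae_forall_partialFourierSum_eq_integral hlam hG hf,
      ae_integrable_inv_one_add_sq_mul β hfi] with ω h1 h2 h3 h4 u hu
    refine ⟨(h1 u hu).1, ?_⟩
    rw [(h1 u hu).2]
    exact tendsto_partialFourierSum hlam hLC hG hu h4 (fun N => h3 N u hu) h2
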